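/- **Bi-Lipschitz MDPs.** Let $\mathcal M=(\mathcal S,\mathcal A,p,r)$ be a Markov decision process on metric spaces with Borel $\sigma$-algebras, with transition kernel $p$, measurable reward $r:\mathcal S\times\mathcal A\to[0,1]$ and initial law $\mu_0$ of $s_0$, where $r$ is $L_r$-Lipschitz and $p$ is $L_p$-Lipschitz in total variation norm with respect to $\rho_{\mathcal S}+\rho_{\mathcal A}$. Let $\Phi$ be a non-empty set of measurable maps $\phi:\mathcal S\to\mathcal A$ (stationary deterministic policies) with a pseudometric $\rho_\Phi$. Assume uniform ergodicity: there are $C>0$, $\alpha\in(0,1)$ such that for every $\phi\in\Phi$ there is a unique probability measure $\mu^{(\infty)}_\phi$ with $\|\mu^{(t)}_{\phi,s}-\mu^{(\infty)}_\phi\|_{TV}\le C\alpha^t$ for all $s\in\mathcal S$, $t\ge 0$, where $\mu^{(t)}_{\phi,s}$ is the law of $s_t$ under $\phi$ given $s_0=s$. Let $$J(\phi)=\liminf_{T\to\infty}\frac1T\,\mathbb E\Big[\sum_{t<T}r(s_t,\phi(s_t))\Big],\qquad J^\star=\sup_{\phi\in\Phi}J(\phi),\qquad \Delta(\phi)=J^\star-J(\phi).$$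 Assume that there are constants $L_1\ge L_2>0$ with $$L_2\,\rho_\Phi(\phi_1,\phi_2)\le|J(\phi_1)-J(\phi_2)|\le L_1\,\rho_\Phi(\phi_1,\phi_2)\qquad\text{for all }\phi_1,\phi_2\in\Phi,$$ and let $L_J\ge0$ be any Lipschitz constant of $J$ on $\Phi$ (for example $L_1$). Let $C_{ub}\in\mathbb R$ and $c_z=2(\max\{2,C_{ub}\}+L_J)$. For $c_{z_1},c_{z_2}>0$ the zooming dimension $d_z^\Phi$ is the infimum of all $d'>0$ such that for every $\gamma\in(0,1]$ $$\mathcal N_{\gamma/c_z}(\{\phi\in\Phi:\gamma<\Delta(\phi)\le2\gamma\})\le c_{z_1}\gamma^{-d'}\quad\text{and}\quad\mathcal N_{\gamma/c_z}(\{\phi\in\Phi:\Delta(\phi)\le\gamma\})\le c_{z_2}\gamma^{-d'},$$ where $\mathcal N_\varepsilon(Y)$ is the least number of sets of diameter at most $\varepsilon$ covering $Y$ (and $\inf\emptyset=\infty$). *Algorithm PZRL-MF*, with horizon $T$, confidence parameter $\delta$ and a constant $c_d$. Let $N_t(\phi)$ be the number of plays of $\phi$ before time $t$, $K_t(\phi)$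 the number of episodes that began before time $t$ and in which $\phi$ was played, $$\mathrm{diam}_t(\phi)=\frac{C}{1-\alpha}\left(\sqrt{\frac{c_d\log(T/\delta)}{1\vee N_t(\phi)}}+\frac{1+K_t(\phi)}{1\vee N_t(\phi)}\right),$$ and let $\mathrm{Index}_t(\phi)$ be the empirical mean of the rewards received before time $t$ while playing $\phi$ ($0$ if $N_t(\phi)=0$) plus $(1+L_J)\,\mathrm{diam}_t(\phi)$. The set of active policies is empty at first. At each time $t=0,\dots,T-1$: (1) as long as the balls $\{\phi'\in\Phi:\rho_\Phi(\phi',\phi)\le\mathrm{diam}_t(\phi)\}$ of the active policies $\phi$ do not cover $\Phi$, a covering oracle returns an uncovered policy, which is activated; (2) if $t=0$ or the current episode is over, a new episode begins, with an active policy $\phi$ of maximal index (ties broken by an arbitrary fixed rule), and of length $1\vee N_t(\phi)$; (3) the action $a_t=\phi(s_t)$ given by the policy $\phi$ of the current episode is taken, and $r(s_t,a_t)$ and $s_{t+1}\sim p(s_t,a_t,\cdot)$ are observed. Its regret is $\mathcal R_\Phi(T)=TJ^\star-\sum_{t=0}^{T-1}r(s_t,a_t)$. Then there are constants $c_{z_1},c_{z_2}>0$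 for which $d_z^\Phi=0$. Moreover, for every $\bar c$ there are $K\in\mathbb R$ and $k\in\mathbb N$ such that, for all $T\ge2$, $\delta\in(0,1)$ and $c_d\le\bar c$ with $$c_d\ \ge\ \frac{\log\!\Big(\frac{c_z}{\delta}\,2^{d_z^\Phi+2}\,T^{\frac{d_z^\Phi+3}{d_z^\Phi+2}}\Big)}{\log(T/\delta)},$$ and for every covering oracle and tie-breaking rule, the regret of PZRL-MF satisfies $$\mathbb P\Big(\mathcal R_\Phi(T)\le K\sqrt T\,\big(\log (T/\delta)\big)^k\Big)\ge1-\delta,$$ i.e. the regret is $\tilde{\mathcal O}(\sqrt T)$ with high probability. -/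

import Mathlib

open MeasureTheory ProbabilityTheory Filter
open scoped ENNReal NNReal

noncomputable section

/-! ### Markov decision processes with average reward -/

/-- A Markov decision process: a transition kernel and a measurable reward function
with values in `[0, 1]`. -/
structure MDP (S A : Type*) [MeasurableSpace S] [MeasurableSpace A] where
  /-- the transition kernel `p(s, a, ·)` -/
  trans : Kernel (S × A) S
  markov : IsMarkovKernel trans
  /-- the reward function `r(s, a)` -/
  reward : S × A → ℝ
  measurable_reward : Measurable reward
  reward_mem : ∀ z, reward z ∈ Set.Icc (0 : ℝ) 1

/-- A stationary deterministic policy: a measurable map from states to actions. -/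
structure Policy (S A : Type*) [MeasurableSpace S] [MeasurableSpace A] where
  act : S → A
  measurable_act : Measurable act

/-- The total variation norm `‖μ - ν‖` of the difference of two finite measures, i.e. the mass of
the total variation of this signed measure (for probability measures it lies in `[0, 2]`). -/
def tvNorm {X : Type*} [MeasurableSpace X] (μ ν : Measure X) [IsFiniteMeasure μ]
    [IsFiniteMeasure ν] : ℝ≥0∞ :=
  (μ.toSignedMeasure - ν.toSignedMeasure).totalVariation Set.univ

namespace MDP

variable {S A : Type*} [MeasurableSpace S] [MeasurableSpace A]

instance (M : MDP S A) : IsMarkovKernel M.trans := M.markov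

/-- The transition kernel of the Markov process induced by the policy `φ`. -/
def policyKernel (M : MDP S A) (φ : Policy S A) : Kernel S S :=
  M.trans.comap (fun s => (s, φ.act s)) (measurable_id.prodMk φ.measurable_act)

instance (M : MDP S A) (φ : Policy S A) : IsMarkovKernel (M.policyKernel φ) := by
  unfold policyKernel; infer_instance

/-- `M.stateLaw φ t s` is the law of the state at time `t` under `φ` when the state at time `0`
is `s`. -/
def stateLaw (M : MDP S A) (φ : Policy S A) : ℕ → Kernel S S
  | 0 => Kernel.id
  | t + 1 => (M.policyKernel φ).comp (stateLaw M φ t)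

instance (M : MDP S A) (φ : Policy S A) (t : ℕ) : IsMarkovKernel (M.stateLaw φ t) := by
  induction t with
  | zero => unfold stateLaw; infer_instance
  | succ t ih => unfold stateLaw; infer_instance

/-- The reward function and the transition kernel are Lipschitz, the latter in total variation.
A function on `S × A` is `L`-Lipschitz for some metric that is dominated by the sum of the metrics
of `S` and `A` if and only if it is `L`-Lipschitz for this sum. -/
def IsLipschitz {S A : Type*} [MetricSpace S] [MeasurableSpace S] [MetricSpace A]
    [MeasurableSpace A] (M : MDP S A) (Lr Lp : ℝ) : Prop :=
  (∀ s s' a a', |M.reward (s, a) - M.reward (s', a')| ≤ Lr * (dist s s' + dist a a')) ∧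
  (∀ s s' a a', tvNorm (M.trans (s, a)) (M.trans (s', a')) ≤
    ENNReal.ofReal (Lp * (dist s s' + dist a a')))

/-- Uniform ergodicity, with constants `C` and `α`, of the Markov processes induced by the
policies in `Φ`. -/
def IsUniformlyErgodic (M : MDP S A) (Φ : Set (Policy S A)) (C α : ℝ) : Prop :=
  0 < C ∧ 0 < α ∧ α < 1 ∧
  ∀ φ ∈ Φ, ∃! μ : ProbabilityMeasure S, ∀ (s : S) (t : ℕ),
    tvNorm (M.stateLaw φ t s) (μ : Measure S) ≤ ENNReal.ofReal (C * α ^ t)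

/-- The long-run average reward of `φ`: the lower limit of `(1 / T) E[∑_{t < T} r(s_t, φ(s_t))]`
for the process induced by `φ` with initial law `μ₀`. -/
def avgReward (M : MDP S A) (μ₀ : Measure S) (φ : Policy S A) : ℝ :=
  liminf (fun T : ℕ => (1 / (T : ℝ)) *
    ∑ t ∈ Finset.range T, ∫ x, M.reward (x, φ.act x) ∂(μ₀.bind (M.stateLaw φ t))) atTop

/-- The best average reward in the class `Φ`. -/
def optReward (M : MDP S A) (μ₀ : Measure S) (Φ : Set (Policy S A)) : ℝ :=
  ⨆ φ : Φ, M.avgReward μ₀ φ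

/-- The suboptimality of a policy with respect to the class `Φ`. -/
def gap (M : MDP S A) (μ₀ : Measure S) (Φ : Set (Policy S A)) (φ : Policy S A) : ℝ :=
  M.optReward μ₀ Φ - M.avgReward μ₀ φ

end MDP

/-! ### Zooming dimension -/

/-- The `ε`-covering number of `Y`: the least number of sets of diameter at most `ε` that
cover `Y`. -/
def coverNumber {X : Type*} [PseudoMetricSpace X] (ε : ℝ) (Y : Set X) : ℕ∞ :=
  ⨅ (U : Finset (Set X)) (_ : (∀ u ∈ U, Metric.ediam u ≤ ENNReal.ofReal ε) ∧
    Y ⊆ ⋃ u ∈ U, u), (U.card : ℕ∞)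

/-- The zooming dimension of the problem given the policy class `Φ`, with constants `cz` (scale)
and `cz₁`, `cz₂` (multipliers): the infimum of all exponents `d > 0` such that, at every scale `γ`,
the sets of policies with gap in `(γ, 2γ]` and with gap at most `γ` have `γ / cz`-covering numbers
at most `cz₁ γ ^ (-d)` and `cz₂ γ ^ (-d)`. Gaps lie in `[0, 1]`, and so do the scales. The infimum
of the empty set is `∞`. -/
def zoomingDim {S A : Type*} [MeasurableSpace S] [MeasurableSpace A] (M : MDP S A)
    (μ₀ : Measure S) (Φ : Set (Policy S A)) [PseudoMetricSpace Φ] (cz cz₁ cz₂ : ℝ) : ℝ≥0∞ :=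
  sInf (ENNReal.ofReal '' {d : ℝ | 0 < d ∧ ∀ γ : ℝ, 0 < γ → γ ≤ 1 →
    (coverNumber (γ / cz) {φ : Φ | γ < M.gap μ₀ Φ φ ∧ M.gap μ₀ Φ φ ≤ 2 * γ} : ℝ≥0∞) ≤
        ENNReal.ofReal (cz₁ * γ ^ (-d)) ∧
    (coverNumber (γ / cz) {φ : Φ | M.gap μ₀ Φ φ ≤ γ} : ℝ≥0∞) ≤
        ENNReal.ofReal (cz₂ * γ ^ (-d))})

/-- The scale constant `cz = 2 (max {2, C_ub} + L_J)` of the zooming dimension. -/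
def zoomScale (LJ Cub : ℝ) : ℝ := 2 * (max 2 Cub + LJ)

/-! ### The algorithm PZRL-MF -/

namespace PZRL

/-- The finite collection `balls` of closed balls, given by centres and radii, covers the space. -/
def Covers {X : Type*} [PseudoMetricSpace X] (balls : Finset (X × ℝ)) : Prop :=
  ∀ x, ∃ b ∈ balls, dist x b.1 ≤ b.2

/-- A covering oracle: given a finite collection of balls it either declares (by `none`) that they
cover the space, or returns a point that is not covered. -/
structure IsCoverOracle {X : Type*} [PseudoMetricSpace X]
    (oracle : Finset (X × ℝ) → Option X) : Prop where
  eq_none_iff : ∀ balls, oracle balls = none ↔ Covers balls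
  not_covered : ∀ balls x, oracle balls = some x → ∀ b ∈ balls, b.2 < dist x b.1

/-- The inputs of PZRL-MF. -/
structure Params where
  /-- horizon -/
  T : ℕ
  /-- confidence parameter -/
  δ : ℝ
  /-- ergodicity constants -/
  C : ℝ
  α : ℝ
  /-- Lipschitz constant of the average reward -/
  LJ : ℝ
  /-- constant in the policy diameter -/
  cd : ℝ

/-- The least admissible value of the constant `cd` in the policy diameter, for zooming dimension
`d` and scale constant `cz`. -/
def cdLowerBound (cz d δ : ℝ) (T : ℕ) : ℝ :=
  Real.log (cz / δ * 2 ^ (d + 2) * (T : ℝ) ^ ((d + 3) / (d + 2))) / Real.log (T / δ)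

/-- The memory of PZRL-MF at the beginning of a time step. -/
structure Memory (X : Type*) where
  /-- the set of active policies -/
  active : Finset X
  /-- the number of plays `N_t(φ)` so far -/
  plays : X → ℕ
  /-- the number of episodes `K_t(φ)` that began so far and in which `φ` was played -/
  episodes : X → ℕ
  /-- the sum of the rewards collected so far while playing `φ` -/
  total : X → ℝ
  /-- the policy of the current episode -/
  current : X
  /-- the number of steps done in the current episode -/
  elapsed : ℕ
  /-- the length `H_k` of the current episode -/
  len : ℕ

variable {X : Type*}

/-- At the start nothing is active, nothing has been played and a new episode is due. (The value of
`current` is overwritten in the first step.) -/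
def Memory.init [Nonempty X] : Memory X where
  active := ∅
  plays := fun _ => 0
  episodes := fun _ => 0
  total := fun _ => 0
  current := Classical.arbitrary X
  elapsed := 0
  len := 0

/-- The policy diameter. -/
def diam (θ : Params) (m : Memory X) (φ : X) : ℝ :=
  θ.C / (1 - θ.α) * (√(θ.cd * Real.log (θ.T / θ.δ) / (max 1 (m.plays φ) : ℕ)) +
    (1 + (m.episodes φ : ℝ)) / (max 1 (m.plays φ) : ℕ))

/-- The model-free UCB index. (The empirical mean of a policy not yet played is `0`.) -/
def index (θ : Params) (m : Memory X) (φ : X) : ℝ :=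
  m.total φ / (m.plays φ : ℝ) + (1 + θ.LJ) * diam θ m φ

open Classical in
/-- The collection of the confidence balls of the policies in `B`. -/
def confBalls (θ : Params) (m : Memory X) (B : Finset X) : Finset (X × ℝ) :=
  B.image fun φ => (φ, diam θ m φ)

open Classical in
/-- The active set after `n` queries of the oracle, each of which activates the uncovered policy
that the oracle returns (if any). -/
def activateN (θ : Params) (oracle : Finset (X × ℝ) → Option X) (m : Memory X) : ℕ → Finset X
  | 0 => m.active
  | n + 1 =>
    match oracle (confBalls θ m (activateN θ oracle m n)) with
    | none => activateN θ oracle m n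
    | some φ => insert φ (activateN θ oracle m n)

open Classical in
/-- The update of the active set: query the oracle until it declares that the confidence balls of
the active policies cover the policy class. (If this never happens, the set is left as it is.) -/
def activate (θ : Params) (oracle : Finset (X × ℝ) → Option X) (m : Memory X) : Finset X :=
  if h : ∃ n, oracle (confBalls θ m (activateN θ oracle m n)) = none then
    activateN θ oracle m (Nat.find h)
  else m.active

open Classical in
/-- The active policies of largest index. -/
def argmaxIndex (θ : Params) (m : Memory X) : Finset X :=
  m.active.filter fun φ => ∀ ψ ∈ m.active, index θ m ψ ≤ index θ m φ

open Classical in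
/-- What PZRL-MF does at the beginning of a time step, before it acts: it updates the active set,
and if the current episode is over it starts a new one, with a policy of maximal index, selected
among the maximizers by `tie`, and of length `1 ∨ N_t(φ)`. -/
def startStep (θ : Params) (oracle : Finset (X × ℝ) → Option X) (tie : Finset X → X)
    (m : Memory X) : Memory X :=
  let m₁ : Memory X := { m with active := activate θ oracle m }
  if m₁.len ≤ m₁.elapsed then
    let φ := tie (argmaxIndex θ m₁)
    { m₁ with
      current := φ
      episodes := Function.update m₁.episodes φ (m₁.episodes φ + 1)
      elapsed := 0
      len := max 1 (m₁.plays φ) }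
  else m₁

open Classical in
/-- The update of the memory after the reward `x` has been received. -/
def record (m : Memory X) (x : ℝ) : Memory X :=
  { m with
    plays := Function.update m.plays m.current (m.plays m.current + 1)
    total := Function.update m.total m.current (m.total m.current + x)
    elapsed := m.elapsed + 1 }

section Run

variable {S A : Type*} [MeasurableSpace S] [MeasurableSpace A]
  (M : MDP S A) (Φ : Set (Policy S A)) [Nonempty Φ] (θ : Params)
  (oracle : Finset (Φ × ℝ) → Option Φ) (tie : Finset Φ → Φ)

/-- The memory at the beginning of time step `t`, when the states visited are `s 0, s 1, …`
(only `s 0, …, s (t - 1)` matter). -/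
def memory (s : ℕ → S) : ℕ → Memory Φ
  | 0 => Memory.init
  | t + 1 =>
    let m := startStep θ oracle tie (memory s t)
    record m (M.reward (s t, m.current.1.act (s t)))

/-- The action taken at time `t` when the states visited are `s 0, s 1, …`
(only `s 0, …, s t` matter). -/
def action (s : ℕ → S) (t : ℕ) : A :=
  (startStep θ oracle tie (memory M Φ θ oracle tie s t)).current.1.act (s t)

/-- The regret at the horizon with respect to the policy class `Φ`, along the states
`s 0, s 1, …`. -/
def regret (μ₀ : Measure S) (s : ℕ → S) : ℝ :=
  θ.T * M.optReward μ₀ Φ -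
    ∑ t ∈ Finset.range θ.T, M.reward (s t, action M Φ θ oracle tie s t)

/-- `s` is the state process of the MDP with initial law `μ₀` when the actions are chosen by
PZRL-MF: given the history up to time `t`, the next state has law `p(s_t, a_t, ·)`. -/
structure IsStateProcess (μ₀ : Measure S) {Ω : Type*} [MeasurableSpace Ω] (P : Measure Ω)
    (s : ℕ → Ω → S) : Prop where
  measurable : ∀ t, Measurable (s t)
  initial : P.map (s 0) = μ₀
  transition : ∀ t < θ.T, ∀ B : Set S, MeasurableSet B →
    P[(s (t + 1) ⁻¹' B).indicator (fun _ => (1 : ℝ)) |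
        MeasurableSpace.comap (fun ω (i : Set.Iic t) => s i ω) MeasurableSpace.pi]
      =ᵐ[P] fun ω => (M.trans (s t ω, action M Φ θ oracle tie (fun i => s i ω) t)).real B

end Run

end PZRL

end

/-!
The theorem is a regret bound for an optimistic algorithm, and the bi-Lipschitz assumption turns
the policy class, as far as covering is concerned, into a subset of the interval `[0, 1]`: a set of
policies is small as soon as the set of its average rewards is small.

**Zooming dimension.** A set of policies whose average rewards lie in an interval of length `γ` is
covered by boundedly many sets of diameter `γ / c_z`, uniformly in `γ`. Hence every positive
exponent is admissible (`exists_zoomingDim_eq_zero`).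

**Concentration.** Write `D = C / (1 - α)`. Uniform ergodicity gives a solution `h` of the Poisson
equation `r_φ - J(φ) = h - P_φ h` with `|h| ≤ D / 2` (`MDP.exists_poisson`). Along the plays of `φ`,
the excess reward `r_φ(s_t) - J(φ)` is therefore the sum of `h(s_t) - h(s_{t+1})`, which telescopes
within each episode (`PZRL.IsRun.abs_telescope_le`), and of a martingale difference with conditional
range `D`, to which the Azuma-Hoeffding inequality applies (`PZRL.measure_noise_le`). The policies
that are played are random, but each is determined by the time of its first play, so that a union
bound over this time, the current time and the number of plays suffices, and with probability at
least `1 - δ` all empirical means are within the confidence radii of the average rewards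
(`PZRL.measure_not_concentrated_le`). For this, the memory of the algorithm has to be measurable
with respect to the history, although the oracle and the tie-breaking rule are arbitrary functions:
they are only applied to quantities with countably many values (`PZRL.isDiscreteVar_memory`).

**Regret on the good event.** Optimism bounds the gap of a policy selected for an episode by a
multiple of its radius at that time, and the number of plays at most doubles during the episode, so
that the gap of every policy is always at most a multiple of its current radius
(`PZRL.IsRun.gap_le`). A newly activated policy lies outside the confidence balls of the active
ones. As distances are comparable to differences of gaps, the numbers `log (1 / √T + Δ(φ))` of the
active policies are separated by a constant, and there are `O(log T)` active policies
(`PZRL.IsRun.card_active_le`). The regret is at most a multiple of the sum of the number of plays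
times the radius, and the Cauchy-Schwarz inequality concludes (`PZRL.IsRun.regret_le`).

An unplayed policy has empirical mean `0`, which is within its radius of the truth only if this
radius is at least `1`. This can fail only when `log (T / δ) < 1 / D ^ 2`; then `T` is bounded, and
so is the regret.
-/

noncomputable section

/-! ### Total variation, ergodicity and the Poisson equation -/

/-- The Jordan decomposition of `μ - ν`, free of signed measures. -/
lemma exists_measure_add_eq_of_tvNorm {X : Type*} [MeasurableSpace X] (μ ν : Measure X)
    [IsFiniteMeasure μ] [IsFiniteMeasure ν] :
    ∃ p n : Measure X, IsFiniteMeasure p ∧ IsFiniteMeasure n ∧ μ + n = ν + p ∧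
      p Set.univ + n Set.univ = tvNorm μ ν := by
  set σ := μ.toSignedMeasure - ν.toSignedMeasure with hσ
  refine ⟨σ.toJordanDecomposition.posPart, σ.toJordanDecomposition.negPart,
    inferInstance, inferInstance, ?_, ?_⟩
  · have h := σ.toSignedMeasure_toJordanDecomposition
    rw [JordanDecomposition.toSignedMeasure] at h
    rw [← Measure.toSignedMeasure_eq_toSignedMeasure_iff, Measure.toSignedMeasure_add,
      Measure.toSignedMeasure_add]
    rw [sub_eq_iff_eq_add] at h
    rw [h, hσ]
    abel
  · rfl

/-- The total variation of a difference of probability measures splits evenly between its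
positive and its negative part, which is where the factor `1 / 2` comes from. -/
lemma abs_integral_sub_integral_le_of_tvNorm_le {X : Type*} [MeasurableSpace X] {μ ν : Measure X}
    [IsProbabilityMeasure μ] [IsProbabilityMeasure ν] {b : ℝ} (hb : 0 ≤ b)
    (h : tvNorm μ ν ≤ ENNReal.ofReal b) {f : X → ℝ} (hf : Measurable f)
    (hf01 : ∀ x, f x ∈ Set.Icc (0 : ℝ) 1) :
    |∫ x, f x ∂μ - ∫ x, f x ∂ν| ≤ b / 2 := by
  obtain ⟨p, n, hp, hn, hadd, htv⟩ := exists_measure_add_eq_of_tvNorm μ ν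
  have hint : ∀ (m : Measure X) [IsFiniteMeasure m], Integrable f m := fun m _ =>
    Integrable.of_mem_Icc 0 1 hf.aemeasurable (Eventually.of_forall hf01)
  have hbd : ∀ (m : Measure X) [IsFiniteMeasure m],
      0 ≤ ∫ x, f x ∂m ∧ ∫ x, f x ∂m ≤ m.real Set.univ := by
    intro m _
    refine ⟨integral_nonneg fun x => (hf01 x).1, ?_⟩
    calc ∫ x, f x ∂m ≤ ∫ _, (1 : ℝ) ∂m :=
          integral_mono (hint m) (integrable_const _) fun x => (hf01 x).2
      _ = m.real Set.univ := by simp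
  have h1 : ∫ x, f x ∂μ + ∫ x, f x ∂n = ∫ x, f x ∂ν + ∫ x, f x ∂p := by
    rw [← integral_add_measure (hint _) (hint _), hadd, integral_add_measure (hint _) (hint _)]
  have h2 : p.real Set.univ = n.real Set.univ := by
    have := congrFun (congrArg Measure.real hadd) Set.univ
    rw [measureReal_add_apply, measureReal_add_apply, probReal_univ (μ := μ),
      probReal_univ (μ := ν)] at this
    linarith
  have h3 : p.real Set.univ + n.real Set.univ ≤ b := by
    rw [← htv] at h
    have := ENNReal.toReal_mono ENNReal.ofReal_ne_top h
    rwa [ENNReal.toReal_ofReal hb, ENNReal.toReal_add (measure_ne_top _ _) (measure_ne_top _ _)]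
      at this
  have := hbd p
  have := hbd n
  rw [abs_le]
  constructor <;> linarith

namespace MDP

variable {S A : Type*} [MeasurableSpace S] [MeasurableSpace A]

/-- The reward collected in one step under a stationary policy, as a function of the state. -/
def policyReward (M : MDP S A) (φ : Policy S A) (x : S) : ℝ := M.reward (x, φ.act x)

lemma measurable_policyReward (M : MDP S A) (φ : Policy S A) : Measurable (M.policyReward φ) :=
  M.measurable_reward.comp (measurable_id.prodMk φ.measurable_act)

lemma policyReward_mem (M : MDP S A) (φ : Policy S A) (x : S) :
    M.policyReward φ x ∈ Set.Icc (0 : ℝ) 1 := M.reward_mem _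

lemma integrable_policyReward (M : MDP S A) (φ : Policy S A) (μ : Measure S) [IsFiniteMeasure μ] :
    Integrable (M.policyReward φ) μ :=
  Integrable.of_mem_Icc 0 1 (M.measurable_policyReward φ).aemeasurable
    (Eventually.of_forall (M.policyReward_mem φ))

lemma integral_policyReward_mem (M : MDP S A) (φ : Policy S A) (μ : Measure S)
    [IsProbabilityMeasure μ] : ∫ x, M.policyReward φ x ∂μ ∈ Set.Icc (0 : ℝ) 1 := by
  refine ⟨integral_nonneg fun x => (M.policyReward_mem φ x).1, ?_⟩
  calc ∫ x, M.policyReward φ x ∂μ ≤ ∫ _, (1 : ℝ) ∂μ :=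
        integral_mono (M.integrable_policyReward φ μ) (integrable_const _)
          fun x => (M.policyReward_mem φ x).2
    _ = 1 := by simp

lemma stateLaw_succ' (M : MDP S A) (φ : Policy S A) (t : ℕ) :
    M.stateLaw φ (t + 1) = (M.stateLaw φ t).comp (M.policyKernel φ) := by
  induction t with
  | zero => simp [stateLaw]
  | succ t ih =>
    conv_rhs => rw [stateLaw]
    rw [stateLaw, ih, Kernel.comp_assoc]

/-- The expected reward at time `t` when the process starts in a given state. -/
def expReward (M : MDP S A) (φ : Policy S A) (t : ℕ) (s : S) : ℝ :=
  ∫ x, M.policyReward φ x ∂(M.stateLaw φ t s)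

lemma measurable_expReward (M : MDP S A) (φ : Policy S A) (t : ℕ) :
    Measurable (M.expReward φ t) :=
  ((M.measurable_policyReward φ).stronglyMeasurable.integral_kernel).measurable

lemma expReward_zero (M : MDP S A) (φ : Policy S A) (s : S) :
    M.expReward φ 0 s = M.policyReward φ s := by
  unfold expReward stateLaw
  rw [Kernel.id_apply, integral_dirac' _ _ (M.measurable_policyReward φ).stronglyMeasurable]

lemma integral_expReward (M : MDP S A) (φ : Policy S A) (t : ℕ) (s : S) :
    ∫ y, M.expReward φ t y ∂(M.policyKernel φ s) = M.expReward φ (t + 1) s := by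
  unfold expReward
  rw [stateLaw_succ', Kernel.integral_comp (M.integrable_policyReward φ _)]

variable {M : MDP S A} {Φ : Set (Policy S A)} {C α : ℝ} {φ : Policy S A}

/-- Under uniform ergodicity the limit inferior in the average reward is a limit, and it is
approached geometrically by the expected rewards, from every initial state. -/
lemma abs_expReward_sub_avgReward_le (hErg : M.IsUniformlyErgodic Φ C α) (hφ : φ ∈ Φ)
    (μ₀ : Measure S) [IsProbabilityMeasure μ₀] (t : ℕ) (s : S) :
    |M.expReward φ t s - M.avgReward μ₀ φ| ≤ C * α ^ t / 2 := by
  obtain ⟨hC, hα0, hα1, herg⟩ := hErg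
  obtain ⟨μ, hμ, -⟩ := herg φ hφ
  set J := ∫ x, M.policyReward φ x ∂(μ : Measure S) with hJ
  have hb : ∀ t : ℕ, 0 ≤ C * α ^ t := fun t => by positivity
  have hexp : ∀ t s, |M.expReward φ t s - J| ≤ C * α ^ t / 2 := fun t s =>
    abs_integral_sub_integral_le_of_tvNorm_le (hb t) (hμ s t) (M.measurable_policyReward φ)
      (M.policyReward_mem φ)
  suffices h : M.avgReward μ₀ φ = J by rw [h]; exact hexp t s
  have hint : ∀ t, Integrable (M.expReward φ t) μ₀ := fun t =>
    Integrable.of_mem_Icc 0 1 (M.measurable_expReward φ t).aemeasurable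
      (Eventually.of_forall fun s => M.integral_policyReward_mem φ _)
  have hmean : ∀ t, ∫ x, M.reward (x, φ.act x) ∂(μ₀.bind (M.stateLaw φ t))
      = ∫ s, M.expReward φ t s ∂μ₀ := fun t =>
    Kernel.integral_comp (κ := Kernel.const Unit μ₀) (a := ())
      (M.integrable_policyReward φ (((M.stateLaw φ t).comp (Kernel.const Unit μ₀)) ()))
  have hlim : Tendsto (fun t => ∫ x, M.reward (x, φ.act x) ∂(μ₀.bind (M.stateLaw φ t)))
      atTop (nhds J) := by
    rw [tendsto_iff_dist_tendsto_zero]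
    have h0 : Tendsto (fun t : ℕ => C * α ^ t / 2) atTop (nhds 0) := by
      simpa using ((tendsto_pow_atTop_nhds_zero_of_lt_one hα0.le hα1).const_mul C).div_const 2
    refine squeeze_zero (fun _ => dist_nonneg) (fun t => ?_) h0
    rw [hmean t, Real.dist_eq]
    have : ∫ s, M.expReward φ t s ∂μ₀ - J = ∫ s, (M.expReward φ t s - J) ∂μ₀ := by
      rw [integral_sub (hint t) (integrable_const _)]; simp
    rw [this]
    have := norm_integral_le_of_norm_le_const (μ := μ₀) (f := fun s => M.expReward φ t s - J)
      (Eventually.of_forall fun s => hexp t s)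
    simpa using this
  have := hlim.cesaro.liminf_eq
  simpa only [avgReward, one_div] using this

lemma avgReward_mem_Icc (hErg : M.IsUniformlyErgodic Φ C α) (hφ : φ ∈ Φ)
    (μ₀ : Measure S) [IsProbabilityMeasure μ₀] : M.avgReward μ₀ φ ∈ Set.Icc (0 : ℝ) 1 := by
  have hne : Nonempty S := nonempty_of_isProbabilityMeasure μ₀
  obtain ⟨s⟩ := hne
  refine isClosed_Icc.mem_of_tendsto (f := fun t => M.expReward φ t s) (b := atTop) ?_
    (Eventually.of_forall fun t => M.integral_policyReward_mem φ _)
  rw [tendsto_iff_dist_tendsto_zero]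
  have h0 : Tendsto (fun t : ℕ => C * α ^ t / 2) atTop (nhds 0) := by
    simpa using
      ((tendsto_pow_atTop_nhds_zero_of_lt_one hErg.2.1.le hErg.2.2.1).const_mul C).div_const 2
  exact squeeze_zero (fun _ => dist_nonneg)
    (fun t => abs_expReward_sub_avgReward_le hErg hφ μ₀ t s) h0

/-- The Poisson equation: `h` is the sum over `t` of the excess of the expected reward at time `t`
over the average reward, a geometric series. -/
lemma exists_poisson (hErg : M.IsUniformlyErgodic Φ C α) (hφ : φ ∈ Φ)
    (μ₀ : Measure S) [IsProbabilityMeasure μ₀] :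
    ∃ h : S → ℝ, Measurable h ∧ (∀ s, |h s| ≤ C / (1 - α) / 2) ∧
      ∀ s, M.policyReward φ s - M.avgReward μ₀ φ = h s - ∫ y, h y ∂(M.policyKernel φ s) := by
  have hα0 := hErg.2.1
  have hα1 := hErg.2.2.1
  set J := M.avgReward μ₀ φ
  have hexp : ∀ t s, ‖M.expReward φ t s - J‖ ≤ C * α ^ t / 2 := fun t s =>
    abs_expReward_sub_avgReward_le hErg hφ μ₀ t s
  have hgeo : HasSum (fun t : ℕ => C * α ^ t / 2) (C / (1 - α) / 2) := by
    simpa [div_eq_mul_inv] using ((hasSum_geometric_of_lt_one hα0.le hα1).mul_left C).div_const 2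
  have hsum : ∀ s, Summable fun t => M.expReward φ t s - J := fun s =>
    Summable.of_norm_bounded hgeo.summable fun t => hexp t s
  have hmeas : ∀ t, Measurable fun s => M.expReward φ t s - J := fun t =>
    (M.measurable_expReward φ t).sub_const J
  refine ⟨fun s => ∑' t, (M.expReward φ t s - J), ?_, ?_, ?_⟩
  · exact measurable_of_tendsto_metrizable
      (fun n => Finset.measurable_fun_sum (Finset.range n) fun t _ => hmeas t)
      (tendsto_pi_nhds.2 fun s => (hsum s).hasSum.tendsto_sum_nat)
  · exact fun s => tsum_of_norm_bounded hgeo fun t => hexp t s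
  · intro s
    have hi : ∀ t, Integrable (fun y => M.expReward φ t y) (M.policyKernel φ s) := fun t =>
      Integrable.of_mem_Icc 0 1 (M.measurable_expReward φ t).aemeasurable
        (Eventually.of_forall fun s => M.integral_policyReward_mem φ _)
    have hi' : ∀ t, Integrable (fun y => M.expReward φ t y - J) (M.policyKernel φ s) := fun t =>
      (hi t).sub (integrable_const _)
    have h1 : ∫ y, ∑' t, (M.expReward φ t y - J) ∂(M.policyKernel φ s)
        = ∑' t, (M.expReward φ (t + 1) s - J) := by
      rw [← integral_tsum_of_summable_integral_norm hi']
      · refine tsum_congr fun t => ?_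
        rw [integral_sub (hi t) (integrable_const _), M.integral_expReward]
        simp
      · refine Summable.of_nonneg_of_le (fun t => integral_nonneg fun _ => norm_nonneg _)
          (fun t => ?_) hgeo.summable
        calc ∫ y, ‖M.expReward φ t y - J‖ ∂(M.policyKernel φ s)
            ≤ ∫ _, C * α ^ t / 2 ∂(M.policyKernel φ s) :=
              integral_mono (hi' t).norm (integrable_const _) fun y => hexp t y
          _ = C * α ^ t / 2 := by simp
    dsimp only
    rw [h1, (hsum s).tsum_eq_zero_add, expReward_zero]
    ring

end MDP

/-! ### Covering numbers and the zooming dimension -/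

/-- A finite family of points with values in an interval of length `b - a` that are pairwise at
distance at least `η` has at most `(b - a) / η + 1` members. -/
lemma card_le_of_separated {ι : Type*} (s : Finset ι) (g : ι → ℝ) {a b η : ℝ} (hη : 0 < η)
    (hab : a ≤ b) (hg : ∀ i ∈ s, g i ∈ Set.Icc a b)
    (hsep : ∀ i ∈ s, ∀ j ∈ s, i ≠ j → η ≤ |g i - g j|) : (s.card : ℝ) ≤ (b - a) / η + 1 := by
  have hcard : s.card ≤ (Finset.range (⌊(b - a) / η⌋₊ + 1)).card := by
    refine Finset.card_le_card_of_injOn (fun i => ⌊(g i - a) / η⌋₊) (fun i hi => ?_) ?_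
    · simp only [Finset.coe_range, Set.mem_Iio, Nat.lt_succ_iff]
      refine Nat.floor_le_floor ?_
      have := (hg i hi).2
      gcongr
    · intro i hi j hj hij
      by_contra hne
      have h1 := hsep i hi j hj hne
      have hi0 : 0 ≤ (g i - a) / η := div_nonneg (by linarith [(hg i hi).1]) hη.le
      have hj0 : 0 ≤ (g j - a) / η := div_nonneg (by linarith [(hg j hj).1]) hη.le
      have hij' : ⌊(g i - a) / η⌋₊ = ⌊(g j - a) / η⌋₊ := hij
      have e1 := Nat.floor_le hi0
      have e2 := Nat.lt_floor_add_one ((g i - a) / η)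
      have e3 := Nat.floor_le hj0
      have e4 := Nat.lt_floor_add_one ((g j - a) / η)
      rw [hij'] at e1 e2
      have h2 : |(g i - a) / η - (g j - a) / η| < 1 := by
        rw [abs_lt]; constructor <;> linarith
      rw [← sub_div, abs_div, abs_of_pos hη, div_lt_one hη] at h2
      have : g i - a - (g j - a) = g i - g j := by ring
      rw [this] at h2
      linarith
  have h0 : (0 : ℝ) ≤ (b - a) / η := div_nonneg (by linarith) hη.le
  calc (s.card : ℝ) ≤ ((⌊(b - a) / η⌋₊ + 1 : ℕ) : ℝ) := by
        rw [Finset.card_range] at hcard; exact_mod_cast hcard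
    _ ≤ (b - a) / η + 1 := by
        push_cast
        linarith [Nat.floor_le h0]

lemma coverNumber_le_of_mem_Icc {X : Type*} [PseudoMetricSpace X] (f : X → ℝ) {c ε a γ : ℝ}
    (hc : 0 < c) (hε : 0 < ε) (hf : ∀ x y, c * dist x y ≤ |f x - f y|) {Y : Set X}
    (hY : ∀ x ∈ Y, f x ∈ Set.Icc a (a + γ)) {n : ℕ} (hn : γ ≤ n * (c * ε)) :
    coverNumber ε Y ≤ (n + 1 : ℕ) := by
  classical
  have hcε : 0 < c * ε := mul_pos hc hε
  set U : ℕ → Set X := fun i => {x | x ∈ Y ∧ ⌊(f x - a) / (c * ε)⌋₊ = i} with hU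
  set F := (Finset.range (n + 1)).image U
  have hcard : F.card ≤ n + 1 := by simpa using Finset.card_image_le (s := Finset.range (n + 1))
  refine le_trans (iInf₂_le F ⟨?_, ?_⟩) (by exact_mod_cast hcard)
  · intro u hu
    obtain ⟨i, -, rfl⟩ := Finset.mem_image.1 hu
    refine Metric.ediam_le fun x hx y hy => ?_
    rw [edist_dist]
    refine ENNReal.ofReal_le_ofReal ?_
    have hx0 : 0 ≤ (f x - a) / (c * ε) := div_nonneg (by linarith [(hY x hx.1).1]) hcε.le
    have hy0 : 0 ≤ (f y - a) / (c * ε) := div_nonneg (by linarith [(hY y hy.1).1]) hcε.le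
    have e1 := Nat.floor_le hx0
    have e2 := Nat.lt_floor_add_one ((f x - a) / (c * ε))
    have e3 := Nat.floor_le hy0
    have e4 := Nat.lt_floor_add_one ((f y - a) / (c * ε))
    rw [hx.2] at e1 e2
    rw [hy.2] at e3 e4
    have h2 : |(f x - a) / (c * ε) - (f y - a) / (c * ε)| ≤ 1 := by
      rw [abs_le]; constructor <;> linarith
    rw [← sub_div, abs_div, abs_of_pos hcε, div_le_one hcε, sub_sub_sub_cancel_right] at h2
    have := (hf x y).trans h2
    exact le_of_mul_le_mul_left this hc
  · intro x hx
    simp only [Set.mem_iUnion]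
    refine ⟨U ⌊(f x - a) / (c * ε)⌋₊, Finset.mem_image_of_mem _ ?_, hx, rfl⟩
    rw [Finset.mem_range, Nat.lt_succ_iff]
    refine Nat.floor_le_of_le ?_
    rw [div_le_iff₀ hcε]
    linarith [(hY x hx).2]

section

variable {S A : Type*} [MeasurableSpace S] [MeasurableSpace A] {M : MDP S A} {μ₀ : Measure S}
  {Φ : Set (Policy S A)}

lemma MDP.avgReward_le_optReward (hJ : ∀ φ : Φ, M.avgReward μ₀ φ ∈ Set.Icc (0 : ℝ) 1) (φ : Φ) :
    M.avgReward μ₀ φ ≤ M.optReward μ₀ Φ :=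
  le_ciSup (f := fun φ : Φ => M.avgReward μ₀ φ) ⟨1, by rintro _ ⟨ψ, rfl⟩; exact (hJ ψ).2⟩ φ

/-- If the distance of policies is controlled by the difference of their average rewards, then
the average reward maps each of the level sets of the gap into an interval whose length is
comparable to the scale, so boundedly many sets suffice at every scale. -/
lemma exists_zoomingDim_eq_zero [Nonempty Φ] [PseudoMetricSpace Φ]
    (hJ : ∀ φ : Φ, M.avgReward μ₀ φ ∈ Set.Icc (0 : ℝ) 1) {c cz : ℝ} (hc : 0 < c) (hcz : 0 < cz)
    (hdist : ∀ φ ψ : Φ, c * dist φ ψ ≤ |M.avgReward μ₀ φ - M.avgReward μ₀ ψ|) :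
    ∃ cz₁ > 0, ∃ cz₂ > 0, zoomingDim M μ₀ Φ cz cz₁ cz₂ = 0 := by
  obtain ⟨n, hn⟩ := exists_nat_ge (cz / c)
  have hcover : ∀ (γ a : ℝ), 0 < γ → ∀ Y : Set Φ,
      (∀ φ ∈ Y, M.avgReward μ₀ φ ∈ Set.Icc a (a + γ)) → coverNumber (γ / cz) Y ≤ (n + 1 : ℕ) := by
    intro γ a hγ Y hY
    refine coverNumber_le_of_mem_Icc (fun φ : Φ => M.avgReward μ₀ φ) hc (div_pos hγ hcz) hdist hY ?_
    rw [div_le_iff₀ hc] at hn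
    calc γ = cz * (γ / cz) := by field_simp
      _ ≤ n * c * (γ / cz) := by gcongr
      _ = n * (c * (γ / cz)) := by ring
  have hbound : ∀ (γ d : ℝ), 0 < γ → γ ≤ 1 → 0 < d → ∀ N : ℕ∞, N ≤ (n + 1 : ℕ) →
      (N : ℝ≥0∞) ≤ ENNReal.ofReal (((n + 1 : ℕ) : ℝ) * γ ^ (-d)) := by
    intro γ d hγ hγ1 hd N hN
    have h1 : (1 : ℝ) ≤ γ ^ (-d) :=
      Real.one_le_rpow_of_pos_of_le_one_of_nonpos hγ hγ1 (by linarith)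
    calc (N : ℝ≥0∞) ≤ (((n + 1 : ℕ) : ℕ∞) : ℝ≥0∞) := ENat.toENNReal_le.2 hN
      _ = ENNReal.ofReal ((n + 1 : ℕ) : ℝ) := by
          simp only [ENat.toENNReal_coe, ENNReal.ofReal_natCast]
      _ ≤ _ := ENNReal.ofReal_le_ofReal (le_mul_of_one_le_right (by positivity) h1)
  have hpos : (0 : ℝ) < ((n + 1 : ℕ) : ℝ) := by positivity
  refine ⟨((n + 1 : ℕ) : ℝ), hpos, ((n + 1 : ℕ) : ℝ), hpos, ?_⟩
  refine le_antisymm (ENNReal.le_of_forall_pos_le_add fun d hd _ => ?_) zero_le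
  rw [zero_add]
  have hd' : (0 : ℝ) < d := hd
  refine sInf_le ⟨(d : ℝ), ⟨hd', fun γ hγ hγ1 => ⟨?_, ?_⟩⟩, ENNReal.ofReal_coe_nnreal⟩
  · refine hbound γ d hγ hγ1 hd' _ (hcover γ (M.optReward μ₀ Φ - 2 * γ) hγ _ ?_)
    rintro φ ⟨h1, h2⟩
    unfold MDP.gap at h1 h2
    constructor <;> linarith
  · refine hbound γ d hγ hγ1 hd' _ (hcover γ (M.optReward μ₀ Φ - γ) hγ _ ?_)
    intro φ h1
    rw [Set.mem_ofPred_eq, MDP.gap] at h1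
    have := MDP.avgReward_le_optReward hJ φ
    constructor <;> linarith

end

/-! ### Runs of the algorithm: activation, counts and telescoping sums -/

namespace PZRL

variable {X : Type*}

section Steps

variable (θ : Params) (oracle : Finset (X × ℝ) → Option X) (tie : Finset X → X)
  (m : Memory X)

lemma startStep_of_lt (h : m.elapsed < m.len) :
    startStep θ oracle tie m = { m with active := activate θ oracle m } := by
  unfold startStep
  exact if_neg (by simpa using h)

open Classical in
lemma startStep_of_le (h : m.len ≤ m.elapsed) :
    startStep θ oracle tie m = { m with
      active := activate θ oracle m
      current := tie (argmaxIndex θ { m with active := activate θ oracle m })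
      episodes := Function.update m.episodes
        (tie (argmaxIndex θ { m with active := activate θ oracle m }))
        (m.episodes (tie (argmaxIndex θ { m with active := activate θ oracle m })) + 1)
      elapsed := 0
      len := max 1 (m.plays (tie (argmaxIndex θ { m with active := activate θ oracle m }))) } := by
  unfold startStep
  exact if_pos h

@[simp] lemma startStep_active :
    (startStep θ oracle tie m).active = activate θ oracle m := by
  unfold startStep; dsimp only; split_ifs <;> rfl

@[simp] lemma startStep_plays : (startStep θ oracle tie m).plays = m.plays := by
  unfold startStep; dsimp only; split_ifs <;> rfl

@[simp] lemma startStep_total : (startStep θ oracle tie m).total = m.total := by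
  unfold startStep; dsimp only; split_ifs <;> rfl

open Classical in
lemma activateN_succ (n : ℕ) : activateN θ oracle m (n + 1) =
    match oracle (confBalls θ m (activateN θ oracle m n)) with
    | none => activateN θ oracle m n
    | some φ => insert φ (activateN θ oracle m n) := rfl

end Steps

/-- The confidence radius of a policy that was played `N` times in `K` episodes. -/
def diamOf (θ : Params) (N K : ℕ) : ℝ :=
  θ.C / (1 - θ.α) * (√(θ.cd * Real.log (θ.T / θ.δ) / (max 1 N : ℕ)) +
    (1 + (K : ℝ)) / (max 1 N : ℕ))

lemma diam_eq (θ : Params) (m : Memory X) (φ : X) :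
    diam θ m φ = diamOf θ (m.plays φ) (m.episodes φ) := rfl

section Activate

variable [PseudoMetricSpace X] {θ : Params} {oracle : Finset (X × ℝ) → Option X} {m : Memory X}

lemma lt_dist_of_oracle_eq_some (ho : IsCoverOracle oracle) {B : Finset X} {φ : X}
    (h : oracle (confBalls θ m B) = some φ) : ∀ ψ ∈ B, diam θ m ψ < dist φ ψ := by
  classical
  intro ψ hψ
  exact ho.not_covered _ _ h (ψ, diam θ m ψ) (Finset.mem_image_of_mem _ hψ)

open Classical in
lemma activateN_induction (ho : IsCoverOracle oracle) {p : Finset X → Prop} (h0 : p m.active)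
    (hins : ∀ B φ, m.active ⊆ B → p B → (∀ ψ ∈ B, diam θ m ψ < dist φ ψ) → p (insert φ B))
    (n : ℕ) : m.active ⊆ activateN θ oracle m n ∧ p (activateN θ oracle m n) := by
  induction n with
  | zero => exact ⟨Finset.Subset.refl _, h0⟩
  | succ n ih =>
    rw [activateN_succ]
    cases h : oracle (confBalls θ m (activateN θ oracle m n)) with
    | none => exact ih
    | some φ =>
      exact ⟨ih.1.trans (Finset.subset_insert _ _),
        hins _ _ ih.1 ih.2 (lt_dist_of_oracle_eq_some ho h)⟩

open Classical in
/-- Induction along the activation loop: every activated policy is farther from those that are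
active than their confidence radii. -/
lemma activate_induction (ho : IsCoverOracle oracle) {p : Finset X → Prop} (h0 : p m.active)
    (hins : ∀ B φ, m.active ⊆ B → p B → (∀ ψ ∈ B, diam θ m ψ < dist φ ψ) → p (insert φ B)) :
    p (activate θ oracle m) := by
  unfold activate
  split_ifs with h
  · exact (activateN_induction ho h0 hins _).2
  · exact h0

lemma active_subset_activate (ho : IsCoverOracle oracle) : m.active ⊆ activate θ oracle m := by
  classical
  exact activate_induction (p := fun B => m.active ⊆ B) ho (Finset.Subset.refl _)
    fun B φ _ hB _ => hB.trans (Finset.subset_insert _ _)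

/-- The activation loop terminates when all radii are bounded below: the activated policies are
then separated, and so are their average rewards. -/
lemma exists_oracle_eq_none (ho : IsCoverOracle oracle) {J : X → ℝ} {c r : ℝ} (hc : 0 < c)
    (hr : 0 < r) (hJ : ∀ φ, J φ ∈ Set.Icc (0 : ℝ) 1)
    (hdist : ∀ φ ψ, c * dist φ ψ ≤ |J φ - J ψ|) (hdiam : ∀ φ, r ≤ diam θ m φ) :
    ∃ n, oracle (confBalls θ m (activateN θ oracle m n)) = none := by
  classical
  by_contra hcon
  push Not at hcon
  choose f hf using fun n => Option.ne_none_iff_exists'.1 (hcon n)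
  have hsucc : ∀ n, activateN θ oracle m (n + 1) = insert (f n) (activateN θ oracle m n) := by
    intro n; rw [activateN_succ, hf n]
  have hmono : Monotone (activateN θ oracle m) :=
    monotone_nat_of_le_succ fun n => by rw [hsucc]; exact Finset.subset_insert _ _
  have hlt : ∀ i j, i < j → c * r ≤ |J (f j) - J (f i)| := by
    intro i j hij
    have hmem : f i ∈ activateN θ oracle m j :=
      hmono (Nat.succ_le_of_lt hij)
        (by rw [Nat.succ_eq_add_one, hsucc]; exact Finset.mem_insert_self _ _)
    have h1 := lt_dist_of_oracle_eq_some ho (hf j) _ hmem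
    refine le_trans ?_ (hdist (f j) (f i))
    have := hdiam (f i)
    gcongr
    linarith
  obtain ⟨N, hN⟩ := exists_nat_gt ((1 - 0) / (c * r) + 1)
  have := card_le_of_separated (Finset.range N) (fun i => J (f i)) (mul_pos hc hr) zero_le_one
    (fun i _ => hJ (f i)) (fun i _ j _ hij => by
      rcases lt_or_gt_of_ne hij with h | h
      · rw [abs_sub_comm]; exact hlt i j h
      · exact hlt j i h)
  rw [Finset.card_range] at this
  linarith

lemma covers_activate (ho : IsCoverOracle oracle)
    (h : ∃ n, oracle (confBalls θ m (activateN θ oracle m n)) = none) (φ : X) :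
    ∃ ψ ∈ activate θ oracle m, dist φ ψ ≤ diam θ m ψ := by
  classical
  have hact : activate θ oracle m = activateN θ oracle m (Nat.find h) := by
    unfold activate; rw [dif_pos h]
  have hc := (ho.eq_none_iff _).1 (Nat.find_spec h)
  obtain ⟨b, hb, hφ⟩ := hc φ
  rw [← hact] at hb
  obtain ⟨ψ, hψ, rfl⟩ := Finset.mem_image.1 hb
  exact ⟨ψ, hψ, hφ⟩

end Activate

/-- `m 0, m 1, …` are the memories of PZRL-MF when the rewards received are `x 0, x 1, …`. -/
structure IsRun [Nonempty X] (θ : Params) (oracle : Finset (X × ℝ) → Option X)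
    (tie : Finset X → X) (x : ℕ → ℝ) (m : ℕ → Memory X) : Prop where
  zero : m 0 = Memory.init
  succ : ∀ t, m (t + 1) = record (startStep θ oracle tie (m t)) (x t)

section Run

variable [Nonempty X] {θ : Params} {oracle : Finset (X × ℝ) → Option X}
  {tie : Finset X → X} {x : ℕ → ℝ} {m : ℕ → Memory X}

namespace IsRun

lemma plays_succ [DecidableEq X] (hm : IsRun θ oracle tie x m) (t : ℕ) (φ : X) :
    (m (t + 1)).plays φ =
      (m t).plays φ + if (startStep θ oracle tie (m t)).current = φ then 1 else 0 := by
  rw [hm.succ t]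
  simp only [record, startStep_plays, Function.update_apply]
  split_ifs with h1 h2 h2
  · rw [h1]
  · exact absurd h1.symm h2
  · exact absurd h2.symm h1
  · rfl

lemma total_succ [DecidableEq X] (hm : IsRun θ oracle tie x m) (t : ℕ) (φ : X) :
    (m (t + 1)).total φ =
      (m t).total φ + if (startStep θ oracle tie (m t)).current = φ then x t else 0 := by
  rw [hm.succ t]
  simp only [record, startStep_total, Function.update_apply]
  split_ifs with h1 h2 h2
  · rw [h1]
  · exact absurd h1.symm h2
  · exact absurd h2.symm h1
  · simp

lemma episodes_succ (hm : IsRun θ oracle tie x m) (t : ℕ) :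
    (m (t + 1)).episodes = (startStep θ oracle tie (m t)).episodes := by
  rw [hm.succ t]; rfl

lemma active_succ (hm : IsRun θ oracle tie x m) (t : ℕ) :
    (m (t + 1)).active = activate θ oracle (m t) := by
  rw [hm.succ t]; simp [record]

lemma plays_eq_sum [DecidableEq X] (hm : IsRun θ oracle tie x m) (t : ℕ) (φ : X) :
    (m t).plays φ =
      ∑ u ∈ Finset.range t, if (startStep θ oracle tie (m u)).current = φ then 1 else 0 := by
  induction t with
  | zero => simp [hm.zero, Memory.init]
  | succ t ih => rw [hm.plays_succ, ih, Finset.sum_range_succ]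

lemma total_eq_sum [DecidableEq X] (hm : IsRun θ oracle tie x m) (t : ℕ) (φ : X) :
    (m t).total φ =
      ∑ u ∈ Finset.range t, if (startStep θ oracle tie (m u)).current = φ then x u else 0 := by
  induction t with
  | zero => simp [hm.zero, Memory.init]
  | succ t ih => rw [hm.total_succ, ih, Finset.sum_range_succ]

lemma plays_le (hm : IsRun θ oracle tie x m) (t : ℕ) (φ : X) : (m t).plays φ ≤ t := by
  classical
  rw [hm.plays_eq_sum]
  calc _ ≤ ∑ u ∈ Finset.range t, 1 := Finset.sum_le_sum fun u _ => by split_ifs <;> simp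
    _ = t := by simp

/-- Within an episode the differences `h u - h (u + 1)` telescope, so that every episode
contributes at most the oscillation of `h`. -/
lemma abs_telescope_le [DecidableEq X] (hm : IsRun θ oracle tie x m) {h : ℕ → ℝ} {D : ℝ}
    (hh : ∀ u, |h u| ≤ D / 2) (φ : X) (t : ℕ) :
    |∑ u ∈ Finset.range t, if (startStep θ oracle tie (m u)).current = φ
      then h u - h (u + 1) else 0| ≤ D * (m t).episodes φ := by
  set Q : ℕ → ℝ := fun t => ∑ u ∈ Finset.range t,
    if (startStep θ oracle tie (m u)).current = φ then h u - h (u + 1) else 0 with hQ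
  have hQs : ∀ t, Q (t + 1) =
      Q t + if (startStep θ oracle tie (m t)).current = φ then h t - h (t + 1) else 0 :=
    fun t => Finset.sum_range_succ _ _
  have key : ∀ t, |Q t| ≤ D * (m t).episodes φ ∧ ((m t).elapsed < (m t).len →
      (m t).current = φ → |Q t + h t| ≤ D * ((m t).episodes φ - 1) + D / 2) := by
    intro t
    induction t with
    | zero => simp [hQ, hm.zero, Memory.init]
    | succ t ih =>
      have hD : 0 ≤ D := by have := (abs_nonneg _).trans (hh 0); linarith
      have step : (startStep θ oracle tie (m t)).current = φ →
          |Q t + h t| ≤ D * ((startStep θ oracle tie (m t)).episodes φ - 1) + D / 2 := by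
        rcases lt_or_ge (m t).elapsed (m t).len with hlt | hle
        · rw [startStep_of_lt _ _ _ _ hlt]
          exact ih.2 hlt
        · rw [startStep_of_le _ _ _ _ hle]
          dsimp only
          intro hc
          simp only [hc, Function.update_apply, if_true]
          push_cast
          calc |Q t + h t| ≤ |Q t| + |h t| := abs_add_le _ _
            _ ≤ _ := by linarith [ih.1, hh t]
      have hcur : (m (t + 1)).current = (startStep θ oracle tie (m t)).current := by
        rw [hm.succ]; rfl
      rw [hQs, hcur, hm.episodes_succ]
      by_cases hc : (startStep θ oracle tie (m t)).current = φ
      · rw [if_pos hc]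
        have h1 := step hc
        refine ⟨?_, fun _ _ => ?_⟩
        · calc |Q t + (h t - h (t + 1))| = |(Q t + h t) - h (t + 1)| := by ring_nf
            _ ≤ |Q t + h t| + |h (t + 1)| := abs_sub _ _
            _ ≤ _ := by linarith [hh (t + 1)]
        · calc |Q t + (h t - h (t + 1)) + h (t + 1)| = |Q t + h t| := by ring_nf
            _ ≤ _ := h1
      · rw [if_neg hc, add_zero]
        refine ⟨ih.1.trans ?_, fun _ h' => absurd h' hc⟩
        gcongr
        rcases lt_or_ge (m t).elapsed (m t).len with hlt | hle
        · rw [startStep_of_lt _ _ _ _ hlt]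
        · rw [startStep_of_le _ _ _ _ hle] at hc ⊢
          dsimp only at hc ⊢
          simp only [Function.update_apply, if_neg (Ne.symm hc), le_refl]
  exact (key t).1

end IsRun

end Run

end PZRL

/-! ### Regret of a run with concentrated rewards -/

lemma log_one_add_le_abs_log_sub_log {a b c : ℝ} (ha : 0 < a) (hb : 0 < b) (hc : 0 < c)
    (h : c * a ≤ |b - a|) : Real.log (1 + c) ≤ |Real.log a - Real.log b| := by
  rcases le_total a b with hab | hab
  · rw [abs_of_nonneg (sub_nonneg.2 hab)] at h
    have h1 : Real.log ((1 + c) * a) ≤ Real.log b :=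
      Real.log_le_log (by positivity) (by linarith)
    rw [Real.log_mul (by positivity) ha.ne'] at h1
    rw [abs_sub_comm]
    exact le_trans (by linarith) (le_abs_self _)
  · rw [abs_of_nonpos (sub_nonpos.2 hab)] at h
    have h1 : Real.log ((1 + c) * b) ≤ Real.log a := by
      refine Real.log_le_log (by positivity) ?_
      nlinarith
    rw [Real.log_mul (by positivity) hb.ne'] at h1
    exact le_trans (by linarith) (le_abs_self _)

namespace PZRL

variable {X : Type*}

/-- The factor `C / (1 - α)` of the confidence radii; it bounds the oscillation of the solutions of
the Poisson equations. -/
def scale (θ : Params) : ℝ := θ.C / (1 - θ.α)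

/-- The confidence level `c_d log (T / δ)`. -/
def level (θ : Params) : ℝ := θ.cd * Real.log (θ.T / θ.δ)

lemma diamOf_eq (θ : Params) (N K : ℕ) : diamOf θ N K =
    scale θ * (√(level θ / (max 1 N : ℕ)) + (1 + (K : ℝ)) / (max 1 N : ℕ)) := rfl

/-- The standing assumptions on the parameters and on the average reward `J`, with supremum
`Jstar`. The last one says that the confidence radius of an unplayed policy exceeds the range of
`J`. -/
structure Regular [PseudoMetricSpace X] (θ : Params) (J : X → ℝ) (c Jstar : ℝ) : Prop where
  scale_pos : 0 < scale θ
  LJ_nonneg : 0 ≤ θ.LJ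
  c_pos : 0 < c
  mem_Icc : ∀ φ, J φ ∈ Set.Icc (0 : ℝ) 1
  isLUB : IsLUB (Set.range J) Jstar
  mul_dist_le : ∀ φ ψ, c * dist φ ψ ≤ |J φ - J ψ|
  abs_sub_le : ∀ φ ψ, |J φ - J ψ| ≤ θ.LJ * dist φ ψ
  one_le : 1 ≤ scale θ * √(level θ)

/-- Along the run, the rewards collected by each policy are close to its average reward times the
number of plays, up to a stochastic error and one oscillation per episode. -/
def Concentrated (θ : Params) (J : X → ℝ) (m : ℕ → Memory X) : Prop :=
  ∀ t ≤ θ.T, ∀ φ, |(m t).total φ - (m t).plays φ * J φ| ≤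
    scale θ * (√(level θ * (m t).plays φ) + (m t).episodes φ)

section Radius

variable {θ : Params}

lemma le_diamOf (hs : 0 < scale θ) {N K t : ℕ} (h : N ≤ t) :
    scale θ / (max 1 t : ℕ) ≤ diamOf θ N K := by
  rw [diamOf_eq, div_eq_mul_one_div]
  have h1 : (1 : ℝ) / (max 1 t : ℕ) ≤ 1 / (max 1 N : ℕ) := by
    have : (max 1 N : ℕ) ≤ (max 1 t : ℕ) := max_le_max le_rfl h
    have h2 : (0 : ℝ) < (max 1 N : ℕ) := by positivity
    exact one_div_le_one_div_of_le h2 (by exact_mod_cast this)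
  have h3 : (1 : ℝ) / (max 1 N : ℕ) ≤ (1 + (K : ℝ)) / (max 1 N : ℕ) := by
    gcongr
    linarith [(Nat.cast_nonneg K : (0 : ℝ) ≤ K)]
  have h4 : 0 ≤ √(level θ / (max 1 N : ℕ)) := Real.sqrt_nonneg _
  gcongr
  linarith

lemma one_le_diamOf_zero (hs : 0 < scale θ) (h1 : 1 ≤ scale θ * √(level θ)) (K : ℕ) :
    1 ≤ diamOf θ 0 K := by
  rw [diamOf_eq]
  refine h1.trans ?_
  gcongr
  simp only [zero_le, sup_of_le_left, Nat.cast_one, div_one]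
  linarith [(Nat.cast_nonneg K : (0 : ℝ) ≤ K)]

lemma one_div_sqrt_le_diamOf (hs : 0 < scale θ) (h1 : 1 ≤ scale θ * √(level θ)) {N K T : ℕ}
    (hT : 1 ≤ T) (hN : N ≤ T) : 1 / √(T : ℝ) ≤ diamOf θ N K := by
  have hL : 0 ≤ level θ := by
    by_contra hneg
    rw [Real.sqrt_eq_zero_of_nonpos (by linarith), mul_zero] at h1
    linarith
  have hn : ((max 1 N : ℕ) : ℝ) ≤ T := by exact_mod_cast max_le hT hN
  have hn0 : (0 : ℝ) < (max 1 N : ℕ) := by positivity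
  rw [diamOf_eq]
  calc 1 / √(T : ℝ) ≤ scale θ * √(level θ) / √(T : ℝ) := by gcongr
    _ = scale θ * √(level θ / T) := by rw [Real.sqrt_div hL]; ring
    _ ≤ scale θ * √(level θ / (max 1 N : ℕ)) := by gcongr
    _ ≤ _ := by
      gcongr
      have : 0 ≤ (1 + (K : ℝ)) / (max 1 N : ℕ) := by positivity
      linarith

/-- When the number of plays at most doubles, the confidence radius is at most halved. -/
lemma diamOf_le_two_mul (hs : 0 < scale θ) (hL : 0 ≤ level θ) {N₀ N₁ K₀ K₁ : ℕ}
    (hN : max 1 N₁ ≤ 2 * max 1 N₀) (hK : K₀ ≤ K₁) :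
    diamOf θ N₀ K₀ ≤ 2 * diamOf θ N₁ K₁ := by
  have hN' : ((max 1 N₁ : ℕ) : ℝ) ≤ 2 * (max 1 N₀ : ℕ) := by exact_mod_cast hN
  have h0 : (0 : ℝ) < (max 1 N₀ : ℕ) := by positivity
  have h1 : (0 : ℝ) < (max 1 N₁ : ℕ) := by positivity
  have hK' : (K₀ : ℝ) ≤ K₁ := by exact_mod_cast hK
  rw [diamOf_eq, diamOf_eq]
  generalize ((max 1 N₁ : ℕ) : ℝ) = n₁ at *
  generalize ((max 1 N₀ : ℕ) : ℝ) = n₀ at *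
  have e1 : √(level θ / n₀) ≤ 2 * √(level θ / n₁) := by
    have : (2 : ℝ) = √4 := by
      rw [show (4 : ℝ) = 2 ^ 2 by norm_num, Real.sqrt_sq (by norm_num)]
    rw [this, ← Real.sqrt_mul (by norm_num)]
    refine Real.sqrt_le_sqrt ?_
    rw [mul_div_assoc', div_le_div_iff₀ h0 h1]
    nlinarith
  have e2 : (1 + (K₀ : ℝ)) / n₀ ≤ 2 * ((1 + (K₁ : ℝ)) / n₁) := by
    rw [mul_div_assoc', div_le_div_iff₀ h0 h1]
    have : (0 : ℝ) ≤ K₀ := Nat.cast_nonneg _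
    nlinarith
  calc _ ≤ scale θ * (2 * √(level θ / n₁) + 2 * ((1 + (K₁ : ℝ)) / n₁)) := by gcongr
    _ = _ := by ring

lemma mul_sqrt_div_eq {n L : ℝ} (hL : 0 ≤ L) : n * √(L / n) = √(L * n) := by
  rw [Real.sqrt_div hL, Real.sqrt_mul hL, mul_div_assoc', mul_comm, mul_div_assoc, Real.div_sqrt]

lemma mul_diamOf_le (hs : 0 < scale θ) (hL : 0 ≤ level θ) (N K : ℕ) :
    N * diamOf θ N K ≤ scale θ * (√(level θ * N) + (1 + K)) := by
  rcases Nat.eq_zero_or_pos N with rfl | hN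
  · simp only [Nat.cast_zero, zero_mul, mul_zero, Real.sqrt_zero]
    positivity
  · have hN' : (0 : ℝ) < N := by exact_mod_cast hN
    rw [diamOf_eq, max_eq_right hN, ← mul_sqrt_div_eq hL]
    refine le_of_eq ?_
    field_simp

end Radius

variable [PseudoMetricSpace X] {θ : Params} {J : X → ℝ} {c Jstar : ℝ}

namespace Regular

lemma level_nonneg (hR : Regular θ J c Jstar) : 0 ≤ level θ := by
  by_contra hneg
  have h1 := hR.one_le
  rw [Real.sqrt_eq_zero_of_nonpos (by linarith), mul_zero] at h1
  linarith

lemma gap_nonneg (hR : Regular θ J c Jstar) (φ : X) : 0 ≤ Jstar - J φ :=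
  sub_nonneg.2 (hR.isLUB.1 ⟨φ, rfl⟩)

lemma gap_le_one [Nonempty X] (hR : Regular θ J c Jstar) (φ : X) : Jstar - J φ ≤ 1 := by
  have h : Jstar ≤ 1 := hR.isLUB.2 (by rintro _ ⟨ψ, rfl⟩; exact (hR.mem_Icc ψ).2)
  linarith [(hR.mem_Icc φ).1]

end Regular

section Run

variable {m : ℕ → Memory X}

lemma Concentrated.abs_mean_sub_le (hcon : Concentrated θ J m) (hR : Regular θ J c Jstar) {t : ℕ}
    (ht : t ≤ θ.T) (φ : X) :
    |(m t).total φ / (m t).plays φ - J φ| ≤ diam θ (m t) φ := by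
  have h := hcon t ht φ
  rw [diam_eq]
  rcases Nat.eq_zero_or_pos ((m t).plays φ) with h0 | hpos
  · rw [h0]
    simp only [Nat.cast_zero, div_zero, zero_sub, abs_neg]
    rw [abs_of_nonneg (hR.mem_Icc φ).1]
    exact (hR.mem_Icc φ).2.trans (one_le_diamOf_zero hR.scale_pos hR.one_le _)
  · have hN : (0 : ℝ) < (m t).plays φ := by exact_mod_cast hpos
    rw [← mul_le_mul_iff_right₀ hN, ← abs_of_pos hN, ← abs_mul, abs_of_pos hN, mul_sub,
      mul_div_cancel₀ _ hN.ne']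
    refine h.trans ?_
    rw [diamOf_eq, max_eq_right hpos, ← mul_sqrt_div_eq hR.level_nonneg]
    have h5 := hR.scale_pos
    calc _ ≤ scale θ * ((m t).plays φ * √(level θ / (m t).plays φ) + (1 + (m t).episodes φ)) := by
          gcongr; linarith
      _ = _ := by field_simp

variable (θ J Jstar) in
/-- What is known about a policy while it is not being played: its episodes have doubled its
number of plays, and its gap is at most a multiple of its confidence radius. -/
def Settled (m : Memory X) (φ : X) : Prop :=
  2 ^ m.episodes φ ≤ max 1 (2 * m.plays φ) ∧ Jstar - J φ ≤ 2 * (2 + θ.LJ) * diam θ m φ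

variable (θ J Jstar) in
/-- What is known about the policy of the current episode; `N₀` and `K₀` are its numbers of plays
and of episodes when this episode began. -/
def Running (m : Memory X) (φ : X) : Prop :=
  ∃ N₀ K₀ : ℕ, m.plays φ = N₀ + m.elapsed ∧ m.len = max 1 N₀ ∧ m.episodes φ = K₀ + 1 ∧
    2 ^ K₀ ≤ max 1 (2 * N₀) ∧ Jstar - J φ ≤ (2 + θ.LJ) * diamOf θ N₀ K₀

lemma Running.gap_le (hR : Regular θ J c Jstar) {m : Memory X} {φ : X}
    (h : Running θ J Jstar m φ) (hle : m.elapsed ≤ m.len) :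
    Jstar - J φ ≤ 2 * (2 + θ.LJ) * diam θ m φ := by
  obtain ⟨N₀, K₀, h1, h2, h3, h4, h5⟩ := h
  have h6 : diamOf θ N₀ K₀ ≤ 2 * diamOf θ (m.plays φ) (m.episodes φ) :=
    diamOf_le_two_mul hR.scale_pos hR.level_nonneg (by omega) (by omega)
  have := hR.LJ_nonneg
  rw [diam_eq]
  calc _ ≤ (2 + θ.LJ) * diamOf θ N₀ K₀ := h5
    _ ≤ (2 + θ.LJ) * (2 * diamOf θ (m.plays φ) (m.episodes φ)) := by gcongr
    _ = _ := by ring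

lemma Running.settled (hR : Regular θ J c Jstar) {m : Memory X} {φ : X}
    (h : Running θ J Jstar m φ) (hle : m.elapsed = m.len) : Settled θ J Jstar m φ := by
  refine ⟨?_, h.gap_le hR hle.le⟩
  obtain ⟨N₀, K₀, h1, h2, h3, h4, h5⟩ := h
  rw [h3, pow_succ]
  omega

omit [PseudoMetricSpace X] in
lemma Running.two_pow_le {m : Memory X} {φ : X} (h : Running θ J Jstar m φ) :
    2 ^ m.episodes φ ≤ 4 * max 1 (m.plays φ) := by
  obtain ⟨N₀, K₀, h1, h2, h3, h4, h5⟩ := h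
  rw [h3, pow_succ]
  omega

variable [Nonempty X] {oracle : Finset (X × ℝ) → Option X}
  {tie : Finset X → X} {x : ℕ → ℝ}

/-- At each time the confidence radii are bounded below, so the activation loop ends with a cover. -/
lemma IsRun.exists_dist_le_diam (hm : IsRun θ oracle tie x m) (hR : Regular θ J c Jstar)
    (ho : IsCoverOracle oracle) (t : ℕ) (φ : X) :
    ∃ ψ ∈ activate θ oracle (m t), dist φ ψ ≤ diam θ (m t) ψ := by
  have hs := hR.scale_pos
  exact covers_activate ho (exists_oracle_eq_none ho hR.c_pos
    (r := scale θ / (max 1 t : ℕ)) (by positivity) hR.mem_Icc hR.mul_dist_le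
    fun φ => by rw [diam_eq]; exact le_diamOf hs (hm.plays_le t φ)) φ

/-- Optimism: the policy selected at the start of an episode has an index of at least `Jstar`,
so its gap is at most a multiple of its confidence radius. -/
lemma gap_tie_argmaxIndex_le (hm : IsRun θ oracle tie x m) (hR : Regular θ J c Jstar)
    (hcon : Concentrated θ J m) (ho : IsCoverOracle oracle)
    (htie : ∀ B : Finset X, B.Nonempty → tie B ∈ B) {t : ℕ} (ht : t ≤ θ.T) {φ : X}
    (hφ : φ = tie (argmaxIndex θ { m t with active := activate θ oracle (m t) })) :
    φ ∈ activate θ oracle (m t) ∧ Jstar - J φ ≤ (2 + θ.LJ) * diam θ (m t) φ := by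
  classical
  set m₁ : Memory X := { m t with active := activate θ oracle (m t) } with hm₁
  obtain ⟨ψ₀, hψ₀, -⟩ := hm.exists_dist_le_diam hR ho t (Classical.arbitrary X)
  have hne : (argmaxIndex θ m₁).Nonempty := by
    obtain ⟨ψ, hψ, hmax⟩ := Finset.exists_max_image m₁.active (index θ m₁) ⟨ψ₀, hψ₀⟩
    exact ⟨ψ, Finset.mem_filter.2 ⟨hψ, hmax⟩⟩
  have hmem := htie _ hne
  rw [← hφ] at hmem
  obtain ⟨hact, hmax⟩ := Finset.mem_filter.1 hmem
  refine ⟨hact, ?_⟩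
  have hidx : Jstar ≤ index θ m₁ φ := by
    refine hR.isLUB.2 ?_
    rintro _ ⟨φ', rfl⟩
    obtain ⟨ψ, hψ, hd⟩ := hm.exists_dist_le_diam hR ho t φ'
    refine le_trans ?_ (hmax ψ hψ)
    have e1 := (abs_le.1 (hcon.abs_mean_sub_le hR ht ψ)).1
    have e2 := (abs_le.1 (hR.abs_sub_le φ' ψ)).2
    have e3 : θ.LJ * dist φ' ψ ≤ θ.LJ * diam θ (m t) ψ :=
      mul_le_mul_of_nonneg_left hd hR.LJ_nonneg
    change J φ' ≤ (m t).total ψ / ((m t).plays ψ : ℝ) + (1 + θ.LJ) * diam θ (m t) ψ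
    linarith
  have e1 := (abs_le.1 (hcon.abs_mean_sub_le hR ht φ)).2
  have e2 : index θ m₁ φ
      = (m t).total φ / ((m t).plays φ : ℝ) + (1 + θ.LJ) * diam θ (m t) φ := rfl
  linarith

/-- The invariant of the run: the policy of an unfinished episode is active and running, and all
other policies are settled. -/
lemma IsRun.invariant (hm : IsRun θ oracle tie x m) (hR : Regular θ J c Jstar)
    (hcon : Concentrated θ J m) (ho : IsCoverOracle oracle)
    (htie : ∀ B : Finset X, B.Nonempty → tie B ∈ B) {t : ℕ} (ht : t ≤ θ.T) :
    (m t).elapsed ≤ (m t).len ∧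
    ((m t).elapsed < (m t).len →
      (m t).current ∈ (m t).active ∧ Running θ J Jstar (m t) (m t).current) ∧
    ∀ φ, φ ≠ (m t).current ∨ (m t).len ≤ (m t).elapsed → Settled θ J Jstar (m t) φ := by
  classical
  induction t with
  | zero =>
    rw [hm.zero]
    refine ⟨le_rfl, fun h => absurd h (lt_irrefl _), fun φ _ => ⟨le_rfl, ?_⟩⟩
    have h1 : 1 ≤ diam θ (Memory.init : Memory X) φ :=
      one_le_diamOf_zero hR.scale_pos hR.one_le _
    have := hR.gap_le_one φ
    have := hR.LJ_nonneg
    nlinarith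
  | succ t ih =>
    obtain ⟨ih1, ih2, ih3⟩ := ih (by omega)
    -- the state of affairs after the possible start of a new episode
    obtain ⟨k1, k2, k3, k4⟩ : (startStep θ oracle tie (m t)).elapsed
          < (startStep θ oracle tie (m t)).len ∧
        (startStep θ oracle tie (m t)).current ∈ activate θ oracle (m t) ∧
        Running θ J Jstar (startStep θ oracle tie (m t)) (startStep θ oracle tie (m t)).current ∧
        ∀ φ ≠ (startStep θ oracle tie (m t)).current,
          Settled θ J Jstar (startStep θ oracle tie (m t)) φ := by
      rcases lt_or_ge (m t).elapsed (m t).len with hlt | hle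
      · rw [startStep_of_lt _ _ _ _ hlt]
        obtain ⟨hact, hrun⟩ := ih2 hlt
        exact ⟨hlt, active_subset_activate ho hact, hrun, fun φ hφ => ih3 φ (Or.inl hφ)⟩
      · rw [startStep_of_le _ _ _ _ hle]
        obtain ⟨g1, g2⟩ := gap_tie_argmaxIndex_le hm hR hcon ho htie (by omega : t ≤ θ.T) rfl
        refine ⟨by simp, g1, ⟨_, (m t).episodes (tie (argmaxIndex θ
          { m t with active := activate θ oracle (m t) })), rfl, rfl, ?_,
          (ih3 _ (Or.inr hle)).1, g2⟩, ?_⟩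
        · dsimp only
          rw [Function.update_self]
        · intro φ hφ
          obtain ⟨s1, s2⟩ := ih3 φ (Or.inr hle)
          unfold Settled
          rw [diam_eq] at s2 ⊢
          dsimp only at hφ ⊢
          rw [Function.update_of_ne hφ]
          exact ⟨s1, s2⟩
    generalize hm' : startStep θ oracle tie (m t) = m' at k1 k2 k3 k4
    have hnext : m (t + 1) = record m' (x t) := by rw [hm.succ t, hm']
    have hact : m'.active = activate θ oracle (m t) := by rw [← hm', startStep_active]
    have hrun : Running θ J Jstar (record m' (x t)) m'.current := by
      obtain ⟨N₀, K₀, r1, r2, r3, r4, r5⟩ := k3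
      refine ⟨N₀, K₀, ?_, r2, r3, r4, r5⟩
      simp only [record, Function.update_self]
      omega
    have hsett : ∀ φ ≠ m'.current, Settled θ J Jstar (record m' (x t)) φ := by
      intro φ hφ
      obtain ⟨s1, s2⟩ := k4 φ hφ
      unfold Settled
      rw [diam_eq] at s2 ⊢
      simp only [record, Function.update_of_ne hφ]
      exact ⟨s1, s2⟩
    rw [hnext]
    refine ⟨k1, fun _ => ⟨?_, hrun⟩, fun φ hφ => ?_⟩
    · change m'.current ∈ m'.active
      rw [hact]; exact k2
    · by_cases hc : φ = m'.current
      · subst hc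
        rcases hφ with hφ | hφ
        · exact absurd rfl hφ
        · exact hrun.settled hR (le_antisymm k1 hφ)
      · exact hsett φ hc

variable (hm : IsRun θ oracle tie x m) (hR : Regular θ J c Jstar)
  (hcon : Concentrated θ J m) (ho : IsCoverOracle oracle)
  (htie : ∀ B : Finset X, B.Nonempty → tie B ∈ B)
include hm hR hcon ho htie

lemma IsRun.gap_le {t : ℕ} (ht : t ≤ θ.T) (φ : X) :
    Jstar - J φ ≤ 2 * (2 + θ.LJ) * diam θ (m t) φ := by
  obtain ⟨h1, h2, h3⟩ := hm.invariant hR hcon ho htie ht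
  by_cases h : φ ≠ (m t).current ∨ (m t).len ≤ (m t).elapsed
  · exact (h3 φ h).2
  · push Not at h
    rw [h.1]
    exact (h2 h.2).2.gap_le hR h1

lemma IsRun.two_pow_episodes_le {t : ℕ} (ht : t ≤ θ.T) (φ : X) :
    2 ^ (m t).episodes φ ≤ 4 * max 1 ((m t).plays φ) := by
  obtain ⟨h1, h2, h3⟩ := hm.invariant hR hcon ho htie ht
  by_cases h : φ ≠ (m t).current ∨ (m t).len ≤ (m t).elapsed
  · have := (h3 φ h).1
    omega
  · push Not at h
    rw [h.1]
    exact (h2 h.2).2.two_pow_le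

lemma IsRun.current_mem_active {t : ℕ} (ht : t ≤ θ.T) :
    (startStep θ oracle tie (m t)).current ∈ activate θ oracle (m t) := by
  classical
  obtain ⟨h1, h2, h3⟩ := hm.invariant hR hcon ho htie ht
  rcases lt_or_ge (m t).elapsed (m t).len with hlt | hle
  · rw [startStep_of_lt _ _ _ _ hlt]
    exact active_subset_activate ho (h2 hlt).1
  · rw [startStep_of_le _ _ _ _ hle]
    exact (gap_tie_argmaxIndex_le hm hR hcon ho htie ht rfl).1

/-- Distinct active policies have gaps that are separated on a logarithmic scale (down to
`1 / √T`): the later one was outside the confidence ball of the earlier one, whose radius is at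
least a multiple of its gap. -/
lemma IsRun.separated (hT : 1 ≤ θ.T) {t : ℕ} (ht : t ≤ θ.T) :
    ∀ φ ∈ (m t).active, ∀ ψ ∈ (m t).active, φ ≠ ψ →
      Real.log (1 + c / (4 * (2 + θ.LJ))) ≤
        |Real.log (1 / √(θ.T : ℝ) + (Jstar - J φ)) -
          Real.log (1 / √(θ.T : ℝ) + (Jstar - J ψ))| := by
  classical
  have hLJ := hR.LJ_nonneg
  have hc := hR.c_pos
  have hT' : (0 : ℝ) < θ.T := by exact_mod_cast hT
  have hε : 0 < 1 / √(θ.T : ℝ) := by positivity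
  induction t with
  | zero => simp [hm.zero, Memory.init]
  | succ t ih =>
    rw [hm.active_succ]
    refine activate_induction (p := fun B => ∀ φ ∈ B, ∀ ψ ∈ B, φ ≠ ψ →
      Real.log (1 + c / (4 * (2 + θ.LJ))) ≤ |Real.log (1 / √(θ.T : ℝ) + (Jstar - J φ)) -
        Real.log (1 / √(θ.T : ℝ) + (Jstar - J ψ))|) ho (ih (by omega)) ?_
    intro B χ hB hsep hχ
    have hnew : ∀ φ ∈ B, Real.log (1 + c / (4 * (2 + θ.LJ))) ≤
        |Real.log (1 / √(θ.T : ℝ) + (Jstar - J φ)) -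
          Real.log (1 / √(θ.T : ℝ) + (Jstar - J χ))| := by
      intro φ hφ
      have g1 := hR.gap_nonneg φ
      have g2 := hR.gap_nonneg χ
      refine log_one_add_le_abs_log_sub_log (by linarith) (by linarith) (by positivity) ?_
      have e1 := hm.gap_le hR hcon ho htie (by omega : t ≤ θ.T) φ
      have e2 : 1 / √(θ.T : ℝ) ≤ diam θ (m t) φ := by
        rw [diam_eq]
        exact one_div_sqrt_le_diamOf hR.scale_pos hR.one_le hT ((hm.plays_le t φ).trans (by omega))
      have e3 := hR.mul_dist_le χ φ
      have e4 : c * diam θ (m t) φ ≤ c * dist χ φ :=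
        mul_le_mul_of_nonneg_left (hχ φ hφ).le hc.le
      have e5 : |1 / √(θ.T : ℝ) + (Jstar - J χ) - (1 / √(θ.T : ℝ) + (Jstar - J φ))|
          = |J χ - J φ| := by
        rw [← abs_neg]; congr 1; ring
      rw [e5]
      refine le_trans ?_ (e4.trans e3)
      rw [div_mul_eq_mul_div, div_le_iff₀ (by positivity), mul_assoc]
      refine mul_le_mul_of_nonneg_left ?_ hc.le
      -- the radius dominates both terms: `1 / √T` since there are at most `T` plays, and a
      -- multiple of the gap
      nlinarith
    intro φ hφ ψ hψ hne
    rcases Finset.mem_insert.1 hφ with rfl | hφ'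
    · rcases Finset.mem_insert.1 hψ with rfl | hψ'
      · exact absurd rfl hne
      · rw [abs_sub_comm]; exact hnew ψ hψ'
    · rcases Finset.mem_insert.1 hψ with rfl | hψ'
      · exact hnew φ hφ'
      · exact hsep φ hφ' ψ hψ' hne

/-- The number of active policies is at most logarithmic in the horizon. -/
lemma IsRun.card_active_le (hT : 1 ≤ θ.T) :
    ((m θ.T).active.card : ℝ) ≤
      Real.log (√(θ.T : ℝ) + 1) / Real.log (1 + c / (4 * (2 + θ.LJ))) + 1 := by
  have hLJ := hR.LJ_nonneg
  have hc := hR.c_pos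
  have hT' : (0 : ℝ) < θ.T := by exact_mod_cast hT
  have hε : 0 < 1 / √(θ.T : ℝ) := by positivity
  have hη : 0 < Real.log (1 + c / (4 * (2 + θ.LJ))) := by
    refine Real.log_pos ?_
    have : 0 < c / (4 * (2 + θ.LJ)) := by positivity
    linarith
  have h := card_le_of_separated (m θ.T).active
    (fun φ => Real.log (1 / √(θ.T : ℝ) + (Jstar - J φ))) (a := Real.log (1 / √(θ.T : ℝ)))
    (b := Real.log (1 / √(θ.T : ℝ) + 1)) hη
    (Real.log_le_log hε (by linarith))
    (fun φ _ => ⟨Real.log_le_log hε (by linarith [hR.gap_nonneg φ]),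
      Real.log_le_log (by linarith [hR.gap_nonneg φ]) (by linarith [hR.gap_le_one φ])⟩)
    (hm.separated hR hcon ho htie hT le_rfl)
  have e : Real.log (1 / √(θ.T : ℝ) + 1) - Real.log (1 / √(θ.T : ℝ))
      = Real.log (√(θ.T : ℝ) + 1) := by
    rw [← Real.log_div (by positivity) hε.ne']
    congr 1
    field_simp
    ring
  rwa [e] at h

/-- The regret is bounded by the sum, over the active policies, of the number of plays times a
multiple of the confidence radius; the square roots add up by the Cauchy-Schwarz inequality. -/
lemma IsRun.regret_le (hT : 1 ≤ θ.T) :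
    θ.T * Jstar - ∑ t ∈ Finset.range θ.T, x t ≤
      (5 + 2 * θ.LJ) * scale θ * (√(level θ) * √((m θ.T).active.card * θ.T) +
        (m θ.T).active.card * (1 + Real.log (4 * θ.T) / Real.log 2)) := by
  classical
  have hLJ := hR.LJ_nonneg
  have hs := hR.scale_pos
  have hL := hR.level_nonneg
  set B := (m θ.T).active with hB
  have hmono : ∀ t, t ≤ θ.T → (m t).active ⊆ B := by
    intro t ht
    induction ht using Nat.decreasingInduction with
    | of_succ k hk ih =>
      exact (active_subset_activate ho).trans ((hm.active_succ k).symm ▸ ih)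
    | self => exact Finset.Subset.refl _
  have hcur : ∀ t ∈ Finset.range θ.T, (startStep θ oracle tie (m t)).current ∈ B := by
    intro t ht
    rw [Finset.mem_range] at ht
    have := hm.current_mem_active hR hcon ho htie ht.le
    rw [← hm.active_succ] at this
    exact hmono (t + 1) ht this
  have hsumx : ∑ t ∈ Finset.range θ.T, x t = ∑ φ ∈ B, (m θ.T).total φ := by
    simp_rw [hm.total_eq_sum]
    rw [Finset.sum_comm]
    refine Finset.sum_congr rfl fun t ht => ?_
    rw [Finset.sum_ite_eq, if_pos (hcur t ht)]
  have hsumN : (θ.T : ℝ) = ∑ φ ∈ B, ((m θ.T).plays φ : ℝ) := by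
    rw [← Nat.cast_sum]
    congr 1
    simp_rw [hm.plays_eq_sum]
    rw [Finset.sum_comm]
    have : ∀ t ∈ Finset.range θ.T,
        (∑ φ ∈ B, if (startStep θ oracle tie (m t)).current = φ then 1 else 0) = 1 :=
      fun t ht => by rw [Finset.sum_ite_eq, if_pos (hcur t ht)]
    rw [Finset.sum_congr rfl this]
    simp
  have hK : ∀ φ, ((m θ.T).episodes φ : ℝ) ≤ Real.log (4 * θ.T) / Real.log 2 := by
    intro φ
    have h1 := hm.two_pow_episodes_le hR hcon ho htie le_rfl φ
    have h2 := hm.plays_le θ.T φ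
    have h3 : 2 ^ (m θ.T).episodes φ ≤ 4 * θ.T := by omega
    have h4 : ((2 : ℝ)) ^ (m θ.T).episodes φ ≤ 4 * θ.T := by exact_mod_cast h3
    rw [le_div_iff₀ (Real.log_pos one_lt_two), ← Real.log_pow]
    exact Real.log_le_log (by positivity) h4
  have hterm : ∀ φ ∈ B, (m θ.T).plays φ * Jstar - (m θ.T).total φ ≤
      (5 + 2 * θ.LJ) * scale θ * (√(level θ) * √((m θ.T).plays φ : ℝ) +
        (1 + Real.log (4 * θ.T) / Real.log 2)) := by
    intro φ _
    have h1 := (abs_le.1 (hcon θ.T le_rfl φ)).1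
    have h2 := hm.gap_le hR hcon ho htie le_rfl φ
    rw [diam_eq] at h2
    have h3 := mul_diamOf_le hs hL ((m θ.T).plays φ) ((m θ.T).episodes φ)
    have h4 : ((m θ.T).plays φ : ℝ) * (Jstar - J φ) ≤
        2 * (2 + θ.LJ) * (scale θ * (√(level θ * (m θ.T).plays φ) +
          (1 + (m θ.T).episodes φ))) :=
      calc _ ≤ ((m θ.T).plays φ : ℝ) * (2 * (2 + θ.LJ) *
            diamOf θ ((m θ.T).plays φ) ((m θ.T).episodes φ)) := by gcongr
        _ = 2 * (2 + θ.LJ) * ((m θ.T).plays φ *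
            diamOf θ ((m θ.T).plays φ) ((m θ.T).episodes φ)) := by ring
        _ ≤ _ := by gcongr
    rw [← Real.sqrt_mul hL]
    calc (m θ.T).plays φ * Jstar - (m θ.T).total φ
        ≤ 2 * (2 + θ.LJ) * (scale θ * (√(level θ * (m θ.T).plays φ) +
            (1 + (m θ.T).episodes φ))) +
          scale θ * (√(level θ * (m θ.T).plays φ) + (1 + (m θ.T).episodes φ)) := by
          nlinarith
      _ = (5 + 2 * θ.LJ) * scale θ * (√(level θ * (m θ.T).plays φ) +
            (1 + (m θ.T).episodes φ)) := by ring
      _ ≤ _ := by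
          have := hK φ
          gcongr
  have hCS : ∑ φ ∈ B, √((m θ.T).plays φ : ℝ) ≤ √(B.card * θ.T) := by
    refine Real.le_sqrt_of_sq_le ?_
    refine (sq_sum_le_card_mul_sum_sq).trans (le_of_eq ?_)
    rw [hsumN]
    congr 1
    exact Finset.sum_congr rfl fun φ _ => Real.sq_sqrt (Nat.cast_nonneg _)
  calc θ.T * Jstar - ∑ t ∈ Finset.range θ.T, x t
      = ∑ φ ∈ B, ((m θ.T).plays φ * Jstar - (m θ.T).total φ) := by
        rw [hsumx, hsumN, Finset.sum_mul, Finset.sum_sub_distrib]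
    _ ≤ ∑ φ ∈ B, (5 + 2 * θ.LJ) * scale θ * (√(level θ) * √((m θ.T).plays φ : ℝ) +
        (1 + Real.log (4 * θ.T) / Real.log 2)) := Finset.sum_le_sum hterm
    _ = (5 + 2 * θ.LJ) * scale θ * (√(level θ) * ∑ φ ∈ B, √((m θ.T).plays φ : ℝ) +
        B.card * (1 + Real.log (4 * θ.T) / Real.log 2)) := by
        rw [← Finset.mul_sum, Finset.sum_add_distrib, ← Finset.mul_sum, Finset.sum_const,
          nsmul_eq_mul]
    _ ≤ _ := by gcongr

end Run

end PZRL

/-! ### Measurability of the memory -/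

/-- A random variable with countable range whose level sets belong to the σ-algebra `mΩ`. No
σ-algebra on the target is needed. -/
structure IsDiscreteVar {Ω β : Type*} (mΩ : MeasurableSpace Ω) (f : Ω → β) : Prop where
  countable_range : (Set.range f).Countable
  measurableSet_eq : ∀ b, MeasurableSet[mΩ] {ω | f ω = b}

namespace IsDiscreteVar

variable {Ω β γ : Type*} {mΩ : MeasurableSpace Ω} {f : Ω → β}

lemma const (b : β) : IsDiscreteVar mΩ (fun _ => b) :=
  ⟨Set.finite_range_const.countable, fun _ => MeasurableSet.const _⟩

/-- A property that may depend on the value of a discrete variable holds on a measurable set if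
it does so for each fixed value. -/
lemma measurableSet_of_forall (hf : IsDiscreteVar mΩ f) {p : β → Ω → Prop}
    (hp : ∀ b, MeasurableSet[mΩ] {ω | p b ω}) : MeasurableSet[mΩ] {ω | p (f ω) ω} := by
  have : {ω | p (f ω) ω} = ⋃ b ∈ Set.range f, ({ω | f ω = b} ∩ {ω | p b ω}) := by
    ext ω
    simp only [Set.mem_iUnion, Set.mem_inter_iff, Set.mem_ofPred_eq]
    exact ⟨fun h => ⟨f ω, ⟨ω, rfl⟩, rfl, h⟩, fun ⟨b, _, h1, h2⟩ => by rw [h1]; exact h2⟩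
  rw [this]
  exact MeasurableSet.biUnion hf.1 fun b _ => (hf.2 b).inter (hp b)

lemma bind (hf : IsDiscreteVar mΩ f) {g : β → Ω → γ} (hg : ∀ b, IsDiscreteVar mΩ (g b)) :
    IsDiscreteVar mΩ (fun ω => g (f ω) ω) := by
  refine ⟨?_, fun c => hf.measurableSet_of_forall fun b => (hg b).2 c⟩
  refine (hf.1.biUnion fun b _ => (hg b).1).mono ?_
  rintro _ ⟨ω, rfl⟩
  simp only [Set.mem_iUnion]
  exact ⟨f ω, ⟨ω, rfl⟩, ω, rfl⟩

lemma comp (hf : IsDiscreteVar mΩ f) (g : β → γ) : IsDiscreteVar mΩ (fun ω => g (f ω)) :=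
  hf.bind (g := fun b _ => g b) fun _ => const _

lemma prodMk (hf : IsDiscreteVar mΩ f) {g : Ω → γ} (hg : IsDiscreteVar mΩ g) :
    IsDiscreteVar mΩ (fun ω => (f ω, g ω)) :=
  hf.bind (g := fun b ω => (b, g ω)) fun b => hg.comp (Prod.mk b)

lemma measurable_bind {E : Type*} [MeasurableSpace E] (hf : IsDiscreteVar mΩ f) {g : β → Ω → E}
    (hg : ∀ b, Measurable[mΩ] (g b)) : Measurable[mΩ] (fun ω => g (f ω) ω) :=
  fun _ hs => hf.measurableSet_of_forall fun b => hg b hs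

end IsDiscreteVar

namespace PZRL

section Memory

variable {X : Type*}

/-- The part of the memory that does not involve the observed rewards. -/
def Memory.erase (m : Memory X) : Memory X := { m with total := fun _ => 0 }

variable (θ : Params) (oracle : Finset (X × ℝ) → Option X) (tie : Finset X → X)

open Classical in
lemma activate_erase (m : Memory X) : activate θ oracle m.erase = activate θ oracle m := by
  have h : activateN θ oracle m.erase = activateN θ oracle m := by
    funext n
    induction n with
    | zero => rfl
    | succ n ih => rw [activateN_succ, activateN_succ, ih]; rfl
  have key : ∀ m' : Memory X, activate θ oracle m' =
      (fun (a : ℕ → Finset X) (b : Finset X → Finset (X × ℝ)) (B : Finset X) =>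
        if h : ∃ n, oracle (b (a n)) = none then a (Nat.find h) else B)
        (activateN θ oracle m') (confBalls θ m') m'.active := fun _ => rfl
  rw [key, key, h]
  rfl

open Classical in
/-- The start of a step, with the rewards erased, when the policies of maximal index are `B`. -/
def startWith (e : Memory X) (B : Finset X) : Memory X :=
  if e.len ≤ e.elapsed then
    { e with
      active := activate θ oracle e
      current := tie B
      episodes := Function.update e.episodes (tie B) (e.episodes (tie B) + 1)
      elapsed := 0
      len := max 1 (e.plays (tie B)) }
  else { e with active := activate θ oracle e }

lemma erase_startStep (m : Memory X) : (startStep θ oracle tie m).erase =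
    startWith θ oracle tie m.erase (argmaxIndex θ
      { m.erase with active := activate θ oracle m.erase, total := m.total }) := by
  classical
  have h : ({ m.erase with active := activate θ oracle m.erase, total := m.total } : Memory X)
      = { m with active := activate θ oracle m } := by rw [activate_erase]; rfl
  rw [h]
  unfold startWith
  rw [activate_erase]
  rcases lt_or_ge m.elapsed m.len with hlt | hle
  · rw [startStep_of_lt _ _ _ _ hlt, if_neg (by simpa [Memory.erase] using hlt)]
    rfl
  · rw [startStep_of_le _ _ _ _ hle, if_pos (by simpa [Memory.erase] using hle)]
    rfl

variable {Ω : Type*} {mΩ : MeasurableSpace Ω}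

lemma isDiscreteVar_argmaxIndex (e : Memory X) {τ : Ω → X → ℝ}
    (hτ : ∀ φ, Measurable[mΩ] fun ω => τ ω φ) :
    IsDiscreteVar mΩ fun ω => argmaxIndex θ { e with total := τ ω } := by
  classical
  have hidx : ∀ φ, Measurable[mΩ] fun ω => index θ { e with total := τ ω } φ := fun φ => by
    change Measurable fun ω => τ ω φ / (e.plays φ : ℝ) + (1 + θ.LJ) * diam θ e φ
    exact ((hτ φ).div_const _).add_const _
  have hp : ∀ φ, MeasurableSet[mΩ] {ω | ∀ ψ ∈ e.active,
      index θ { e with total := τ ω } ψ ≤ index θ { e with total := τ ω } φ} := by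
    intro φ
    have : {ω | ∀ ψ ∈ e.active,
      index θ { e with total := τ ω } ψ ≤ index θ { e with total := τ ω } φ} =
      ⋂ ψ ∈ e.active, {ω | index θ { e with total := τ ω } ψ ≤
        index θ { e with total := τ ω } φ} := by ext; simp
    rw [this]
    exact Finset.measurableSet_biInter _ fun ψ _ => measurableSet_le (hidx ψ) (hidx φ)
  constructor
  · refine (e.active.powerset.finite_toSet.subset ?_).countable
    rintro _ ⟨ω, rfl⟩
    exact Finset.mem_coe.2 (Finset.mem_powerset.2 (Finset.filter_subset _ _))
  · intro B
    by_cases hB : B ⊆ e.active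
    · have : {ω | argmaxIndex θ { e with total := τ ω } = B} =
          ⋂ φ ∈ e.active, {ω | (∀ ψ ∈ e.active, index θ { e with total := τ ω } ψ ≤
            index θ { e with total := τ ω } φ) ↔ φ ∈ B} := by
        ext ω
        simp only [Set.mem_ofPred_eq, Set.mem_iInter]
        constructor
        · rintro rfl φ hφ
          simp [argmaxIndex, hφ]
        · intro h
          ext φ
          constructor
          · intro hφ
            obtain ⟨h1, h2⟩ := Finset.mem_filter.1 hφ
            exact (h φ h1).1 h2
          · intro hφ
            exact Finset.mem_filter.2 ⟨hB hφ, (h φ (hB hφ)).2 hφ⟩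
      rw [this]
      refine Finset.measurableSet_biInter _ fun φ _ => ?_
      by_cases hφ : φ ∈ B
      · simpa only [hφ, iff_true] using hp φ
      · simp only [hφ, iff_false]
        exact (hp φ).compl
    · have : {ω | argmaxIndex θ { e with total := τ ω } = B} = ∅ := by
        ext ω
        simp only [Set.mem_ofPred_eq, Set.mem_empty_iff_false, iff_false]
        rintro rfl
        exact hB (Finset.filter_subset _ _)
      rw [this]
      exact MeasurableSet.empty

lemma isDiscreteVar_erase_startStep {f : Ω → Memory X}
    (hf : IsDiscreteVar mΩ fun ω => (f ω).erase)
    (htot : ∀ φ, Measurable[mΩ] fun ω => (f ω).total φ) :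
    IsDiscreteVar mΩ fun ω => (startStep θ oracle tie (f ω)).erase := by
  simp_rw [erase_startStep]
  refine hf.bind (g := fun e ω => startWith θ oracle tie e (argmaxIndex θ
      { e with active := activate θ oracle e, total := (f ω).total })) fun e => ?_
  exact (isDiscreteVar_argmaxIndex θ { e with active := activate θ oracle e } htot).comp
    (startWith θ oracle tie e)

end Memory

section Measurability

variable {S A : Type*} [MeasurableSpace S] [MeasurableSpace A]
  (M : MDP S A) (Φ : Set (Policy S A)) [Nonempty Φ] (θ : Params)
  (oracle : Finset (Φ × ℝ) → Option Φ) (tie : Finset Φ → Φ)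

/-- The policy played at time `t` when the states visited are `s 0, s 1, …`. -/
def played (s : ℕ → S) (t : ℕ) : Φ :=
  (startStep θ oracle tie (memory M Φ θ oracle tie s t)).current

lemma isRun_memory (s : ℕ → S) : IsRun θ oracle tie
    (fun t => M.policyReward (played M Φ θ oracle tie s t).1 (s t))
    (memory M Φ θ oracle tie s) :=
  ⟨rfl, fun _ => rfl⟩

variable {Ω : Type*} {mΩ : MeasurableSpace Ω} {s : ℕ → Ω → S}

/-- The oracle and the tie-breaking rule are arbitrary functions, but they are applied only to
discrete variables; the rewards enter through finitely many comparisons of indices. -/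
lemma isDiscreteVar_memory (t : ℕ) (hs : ∀ u < t, Measurable[mΩ] (s u)) :
    (IsDiscreteVar mΩ fun ω => (memory M Φ θ oracle tie (fun u => s u ω) t).erase) ∧
    ∀ φ, Measurable[mΩ] fun ω => (memory M Φ θ oracle tie (fun u => s u ω) t).total φ := by
  classical
  induction t with
  | zero => exact ⟨IsDiscreteVar.const (Memory.erase Memory.init), fun φ => measurable_const⟩
  | succ t ih =>
    obtain ⟨ih1, ih2⟩ := ih fun u hu => hs u (by omega)
    have h1 := isDiscreteVar_erase_startStep θ oracle tie ih1 ih2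
    refine ⟨h1.comp fun e => (record e 0).erase, fun φ => ?_⟩
    simp_rw [(isRun_memory M Φ θ oracle tie _).total_succ]
    refine (ih2 φ).add ?_
    have h2 : Measurable fun ω => if played M Φ θ oracle tie (fun u => s u ω) t = φ then
        M.policyReward (played M Φ θ oracle tie (fun u => s u ω) t).1 (s t ω) else 0 :=
      (h1.comp Memory.current).measurable_bind (g := fun ψ ω =>
        if ψ = φ then M.policyReward ψ.1 (s t ω) else 0) fun ψ => by
          split_ifs
          · exact (M.measurable_policyReward _).comp (hs t (by omega))
          · exact measurable_const
    convert h2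
    rfl

lemma isDiscreteVar_played (t : ℕ) (hs : ∀ u < t, Measurable[mΩ] (s u)) :
    IsDiscreteVar mΩ fun ω => played M Φ θ oracle tie (fun u => s u ω) t := by
  obtain ⟨h1, h2⟩ := isDiscreteVar_memory M Φ θ oracle tie t hs
  exact (isDiscreteVar_erase_startStep θ oracle tie h1 h2).comp Memory.current

end Measurability

end PZRL

/-! ### The Markov property of the controlled process -/

namespace PZRL

/-- The σ-algebra generated by the states up to time `t`. -/
@[reducible] def history {S Ω : Type*} [MeasurableSpace S] (s : ℕ → Ω → S) (t : ℕ) :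
    MeasurableSpace Ω :=
  MeasurableSpace.comap (fun ω (i : Set.Iic t) => s i ω) MeasurableSpace.pi

lemma measurable_history {S Ω : Type*} [MeasurableSpace S] (s : ℕ → Ω → S) {u t : ℕ} (h : u ≤ t) :
    Measurable[history s t] (s u) :=
  (measurable_pi_apply (⟨u, h⟩ : Set.Iic t)).comp
    (comap_measurable (fun ω (i : Set.Iic t) => s i ω))

lemma history_le {S Ω : Type*} [MeasurableSpace S] {mΩ : MeasurableSpace Ω} {s : ℕ → Ω → S}
    (hs : ∀ t, Measurable (s t)) (t : ℕ) : history s t ≤ mΩ :=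
  (measurable_pi_lambda (fun ω (i : Set.Iic t) => s i ω) fun i => hs i).comap_le

section

variable {S A : Type*} [MeasurableSpace S] [MeasurableSpace A]
  {M : MDP S A} {Φ : Set (Policy S A)} [Nonempty Φ] {θ : Params}
  {oracle : Finset (Φ × ℝ) → Option Φ} {tie : Finset Φ → Φ}
  {μ₀ : Measure S} {Ω : Type*} [mΩ : MeasurableSpace Ω] {P : Measure Ω} [IsProbabilityMeasure P]
  {s : ℕ → Ω → S}

/-- On an event of the history on which the policy `φ` is played, the next state has the law
prescribed by the kernel of `φ`. -/
lemma IsStateProcess.setLIntegral_comp (hP : IsStateProcess M Φ θ oracle tie μ₀ P s) {t : ℕ}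
    (ht : t < θ.T) {φ : Φ} {E : Set Ω} (hE : MeasurableSet[history s t] E)
    (hEφ : ∀ ω ∈ E, played M Φ θ oracle tie (fun u => s u ω) t = φ)
    {g : S → ℝ≥0∞} (hg : Measurable g) :
    ∫⁻ ω in E, g (s (t + 1) ω) ∂P = ∫⁻ ω in E, ∫⁻ y, g y ∂(M.policyKernel φ.1 (s t ω)) ∂P := by
  have hle := history_le hP.measurable t
  have hE' : MeasurableSet E := hle _ hE
  have hker : Measurable fun ω => M.policyKernel φ.1 (s t ω) :=
    (M.policyKernel φ.1).measurable.comp (hP.measurable t)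
  have hlaw : (P.restrict E).map (s (t + 1)) =
      (P.restrict E).bind fun ω => M.policyKernel φ.1 (s t ω) := by
    ext B hB
    rw [Measure.map_apply (hP.measurable _) hB, Measure.bind_apply hB hker.aemeasurable,
      Measure.restrict_apply ((hP.measurable _) hB)]
    have hB' : MeasurableSet (s (t + 1) ⁻¹' B) := hP.measurable _ hB
    have h1 : ∫ ω in E, (s (t + 1) ⁻¹' B).indicator (fun _ => (1 : ℝ)) ω ∂P
        = ∫ ω in E, (M.policyKernel φ.1 (s t ω)).real B ∂P := by
      rw [← setIntegral_condExp hle ((integrable_const (1 : ℝ)).indicator hB') hE]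
      refine setIntegral_congr_ae hE' ?_
      filter_upwards [hP.transition t ht B hB] with ω hω hωE
      refine hω.trans ?_
      have : action M Φ θ oracle tie (fun i => s i ω) t = φ.1.act (s t ω) := by
        rw [← hEφ ω hωE]; rfl
      rw [this]
      rfl
    rw [integral_indicator hB', Measure.restrict_restrict hB', setIntegral_const, smul_eq_mul,
      mul_one] at h1
    rw [← ENNReal.ofReal_toReal (measure_ne_top P _)]
    change ENNReal.ofReal (P.real (s (t + 1) ⁻¹' B ∩ E)) = _
    rw [h1, ofReal_integral_eq_lintegral_ofReal]
    · refine lintegral_congr fun ω => ?_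
      exact ENNReal.ofReal_toReal (measure_ne_top _ _)
    · refine Integrable.of_mem_Icc 0 1 ?_ (Eventually.of_forall fun ω =>
        ⟨measureReal_nonneg, measureReal_le_one⟩)
      exact ((Measure.measurable_coe hB).comp hker).ennreal_toReal.aemeasurable
    · exact Eventually.of_forall fun ω => measureReal_nonneg
  rw [← lintegral_map hg (hP.measurable _), hlaw,
    Measure.lintegral_bind hker.aemeasurable hg.aemeasurable]

lemma IsStateProcess.setLIntegral_mul_comp (hP : IsStateProcess M Φ θ oracle tie μ₀ P s) {t : ℕ}
    (ht : t < θ.T) {φ : Φ} {E : Set Ω} (hE : MeasurableSet[history s t] E)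
    (hEφ : ∀ ω ∈ E, played M Φ θ oracle tie (fun u => s u ω) t = φ)
    {g : S → ℝ≥0∞} (hg : Measurable g) {W : Ω → ℝ≥0∞} (hW : Measurable[history s t] W) :
    ∫⁻ ω in E, W ω * g (s (t + 1) ω) ∂P =
      ∫⁻ ω in E, W ω * ∫⁻ y, g y ∂(M.policyKernel φ.1 (s t ω)) ∂P := by
  have hle := history_le hP.measurable t
  have hg1 : Measurable fun ω => g (s (t + 1) ω) := hg.comp (hP.measurable _)
  have hg2 : Measurable fun ω => ∫⁻ y, g y ∂(M.policyKernel φ.1 (s t ω)) :=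
    (hg.lintegral_kernel (κ := M.policyKernel φ.1)).comp (hP.measurable t)
  -- both sides are integrals of `W` for measures that agree on the history
  have hwd : ((P.restrict E).withDensity fun ω => g (s (t + 1) ω)).trim hle =
      ((P.restrict E).withDensity fun ω =>
        ∫⁻ y, g y ∂(M.policyKernel φ.1 (s t ω))).trim hle := by
    refine @Measure.ext _ (history s t) _ _ fun E' hE'' => ?_
    rw [trim_measurableSet_eq hle hE'', trim_measurableSet_eq hle hE'',
      withDensity_apply _ (hle _ hE''), withDensity_apply _ (hle _ hE''),
      Measure.restrict_restrict (hle _ hE'')]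
    exact hP.setLIntegral_comp ht (@MeasurableSet.inter _ (history s t) _ _ hE'' hE)
      (fun ω hω => hEφ ω hω.2) hg
  have h1 := lintegral_trim (μ := (P.restrict E).withDensity fun ω => g (s (t + 1) ω)) hle hW
  have h2 := lintegral_trim (μ := (P.restrict E).withDensity fun ω =>
        ∫⁻ y, g y ∂(M.policyKernel φ.1 (s t ω))) hle hW
  rw [hwd, h2, lintegral_withDensity_eq_lintegral_mul _ hg2 (hW.mono hle le_rfl),
    lintegral_withDensity_eq_lintegral_mul _ hg1 (hW.mono hle le_rfl)] at h1
  simp only [Pi.mul_apply, mul_comm (g _), mul_comm (∫⁻ y, g y ∂_)] at h1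
  exact h1.symm

/-- The Markov property of the controlled process: `d` is a discrete variable of the history that
determines the policy played. -/
lemma IsStateProcess.lintegral_mul_comp (hP : IsStateProcess M Φ θ oracle tie μ₀ P s) {t : ℕ}
    (ht : t < θ.T) {β : Type*} {d : Ω → β} (hd : IsDiscreteVar (history s t) d) {π : β → Φ}
    (hπ : ∀ ω, played M Φ θ oracle tie (fun u => s u ω) t = π (d ω))
    {g : β → S → ℝ≥0∞} (hg : ∀ b, Measurable (g b)) {W : Ω → ℝ≥0∞}
    (hW : Measurable[history s t] W) :
    ∫⁻ ω, W ω * g (d ω) (s (t + 1) ω) ∂P =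
      ∫⁻ ω, W ω * ∫⁻ y, g (d ω) y ∂(M.policyKernel (π (d ω)).1 (s t ω)) ∂P := by
  have hle := history_le hP.measurable t
  have : Countable (Set.range d) := hd.countable_range.to_subtype
  have hU : (⋃ b : Set.range d, {ω | d ω = b}) = Set.univ := by
    ext ω
    simp only [Set.mem_iUnion, Set.mem_ofPred_eq, Set.mem_univ, iff_true]
    exact ⟨⟨d ω, ω, rfl⟩, rfl⟩
  have hmeas : ∀ b : Set.range d, MeasurableSet {ω | d ω = b} :=
    fun b => hle _ (hd.measurableSet_eq b)
  have hdisj : Pairwise (Function.onFun Disjoint fun b : Set.range d => {ω | d ω = b}) := by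
    intro b b' hbb
    refine Set.disjoint_left.2 fun ω h1 h2 => hbb (Subtype.ext ?_)
    exact Eq.trans (Eq.symm h1) h2
  rw [← setLIntegral_univ, ← hU, lintegral_iUnion hmeas hdisj, ← setLIntegral_univ (μ := P),
    ← hU, lintegral_iUnion hmeas hdisj]
  refine tsum_congr fun b => ?_
  have e := hP.setLIntegral_mul_comp ht (hd.measurableSet_eq b)
    (fun ω (hω : d ω = b) => by rw [hπ, hω]) (hg b) hW
  calc _ = ∫⁻ ω in {ω | d ω = b}, W ω * g b (s (t + 1) ω) ∂P :=
        setLIntegral_congr_fun (hmeas b) fun ω (hω : d ω = b) => by rw [hω]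
    _ = _ := e
    _ = _ := setLIntegral_congr_fun (hmeas b) fun ω (hω : d ω = b) => by rw [hω]

end

/-- Hoeffding's lemma for the exponential moment of a function with values in `[-D / 2, D / 2]`. -/
lemma lintegral_exp_le_of_abs_le {S : Type*} [MeasurableSpace S] (κ : Measure S)
    [IsProbabilityMeasure κ] {h : S → ℝ} (hh : Measurable h) {D : ℝ} (hD : ∀ y, |h y| ≤ D / 2)
    (l : ℝ) : ∫⁻ y, ENNReal.ofReal (Real.exp (l * h y)) ∂κ ≤
      ENNReal.ofReal (Real.exp (l * ∫ y, h y ∂κ + l ^ 2 * D ^ 2 / 8)) := by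
  have hmem : ∀ᵐ y ∂κ, h y ∈ Set.Icc (-(D / 2)) (D / 2) :=
    Eventually.of_forall fun y => abs_le.1 (hD y)
  have hsub := hasSubgaussianMGF_of_mem_Icc hh.aemeasurable hmem
  have hint := hsub.integrable_exp_mul l
  have hmgf := hsub.mgf_le l
  rw [← ofReal_integral_eq_lintegral_ofReal (integrable_exp_mul_of_mem_Icc hh.aemeasurable hmem)
    (Eventually.of_forall fun _ => (Real.exp_pos _).le)]
  refine ENNReal.ofReal_le_ofReal ?_
  unfold mgf at hmgf
  set m := ∫ y, h y ∂κ
  have e1 : ∀ y, Real.exp (l * h y) = Real.exp (l * m) * Real.exp (l * (h y - m)) := by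
    intro y; rw [← Real.exp_add]; congr 1; ring
  simp_rw [e1]
  rw [integral_const_mul, Real.exp_add]
  refine mul_le_mul_of_nonneg_left (hmgf.trans (le_of_eq ?_)) (Real.exp_pos _).le
  congr 1
  push_cast
  rw [Real.norm_eq_abs, div_pow, sq_abs]
  ring

end PZRL

/-! ### Azuma-Hoeffding inequality for the plays of one policy -/

namespace PZRL

section

variable {S A : Type*} [MeasurableSpace S] [MeasurableSpace A]
  (M : MDP S A) (Φ : Set (Policy S A)) [Nonempty Φ] (θ : Params)
  (oracle : Finset (Φ × ℝ) → Option Φ) (tie : Finset Φ → Φ) (h : Φ → S → ℝ)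

open Classical in
/-- The martingale difference at time `u` for the policy that is played at time `j`, given
solutions `h` of the Poisson equations; it vanishes when this policy is not played at time `u`, and
also before time `j`, when it is not yet known which policy this is. -/
def noise (s : ℕ → S) (j u : ℕ) : ℝ :=
  if j ≤ u ∧ played M Φ θ oracle tie s u = played M Φ θ oracle tie s j then
    h (played M Φ θ oracle tie s j) (s (u + 1)) -
      ∫ y, h (played M Φ θ oracle tie s j) y
        ∂(M.policyKernel (played M Φ θ oracle tie s j).1 (s u))
  else 0

open Classical in
/-- The number of times in `[j, t)` at which the policy played at time `j` is played. -/
def count (s : ℕ → S) (j t : ℕ) : ℕ :=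
  ∑ u ∈ Finset.range t,
    if j ≤ u ∧ played M Φ θ oracle tie s u = played M Φ θ oracle tie s j then 1 else 0

/-- The exponential supermartingale of the Azuma-Hoeffding inequality. -/
def expMart (D l : ℝ) (s : ℕ → S) (j t : ℕ) : ℝ :=
  Real.exp (l * ∑ u ∈ Finset.range t, noise M Φ θ oracle tie h s j u -
    l ^ 2 * D ^ 2 / 8 * count M Φ θ oracle tie s j t)

variable {M Φ θ oracle tie h}
  {Ω : Type*} {s : ℕ → Ω → S}

lemma isDiscreteVar_played_history {u t : ℕ} (hut : u ≤ t) :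
    IsDiscreteVar (history s t) fun ω => played M Φ θ oracle tie (fun v => s v ω) u :=
  isDiscreteVar_played M Φ θ oracle tie u fun v hv => measurable_history s (by omega)

lemma isDiscreteVar_played_pair {j u t : ℕ} (hj : j ≤ t) (hu : u ≤ t) :
    IsDiscreteVar (history s t) fun ω => (played M Φ θ oracle tie (fun v => s v ω) j,
      played M Φ θ oracle tie (fun v => s v ω) u) :=
  (isDiscreteVar_played_history hj).prodMk (isDiscreteVar_played_history hu)

lemma measurable_noise (hh : ∀ φ, Measurable (h φ)) {j u t : ℕ} (hut : u < t) :
    Measurable[history s t] fun ω => noise M Φ θ oracle tie h (fun v => s v ω) j u := by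
  classical
  unfold noise
  by_cases hju : j ≤ u
  · simp only [hju, true_and]
    refine (isDiscreteVar_played_pair (by omega : j ≤ t) (by omega : u ≤ t)).measurable_bind
      (g := fun (d : Φ × Φ) ω => if d.2 = d.1 then
        h d.1 (s (u + 1) ω) - ∫ y, h d.1 y ∂(M.policyKernel d.1.1 (s u ω)) else 0) ?_
    rintro ⟨a, b⟩
    dsimp only
    split_ifs
    · refine ((hh a).comp (measurable_history s hut)).sub ?_
      exact ((hh a).stronglyMeasurable.integral_kernel (κ := M.policyKernel a.1)).measurable.comp
        (measurable_history s hut.le)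
    · exact measurable_const
  · simp only [hju, false_and, if_false]
    exact measurable_const

lemma measurable_count {j t : ℕ} :
    Measurable[history s t] fun ω => (count M Φ θ oracle tie (fun v => s v ω) j t : ℝ) := by
  classical
  unfold count
  push_cast
  refine @Finset.measurable_fun_sum _ _ _ _ _ _ (history s t) _ _ fun u hu => ?_
  rw [Finset.mem_range] at hu
  by_cases hju : j ≤ u
  · simp only [hju, true_and]
    exact (isDiscreteVar_played_pair (by omega : j ≤ t) (by omega : u ≤ t)).measurable_bind
      (g := fun (d : Φ × Φ) _ => if d.2 = d.1 then (1 : ℝ) else 0) fun _ => measurable_const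
  · simp only [hju, false_and, if_false]
    exact measurable_const

lemma measurable_expMart (hh : ∀ φ, Measurable (h φ)) (D l : ℝ) (j t : ℕ) :
    Measurable[history s t] fun ω => expMart M Φ θ oracle tie h D l (fun v => s v ω) j t := by
  refine Real.measurable_exp.comp (Measurable.sub (Measurable.const_mul ?_ _)
    (measurable_count.const_mul _))
  exact @Finset.measurable_fun_sum _ _ _ _ _ _ (history s t) _ _ fun u hu =>
    measurable_noise hh (Finset.mem_range.1 hu)

open Classical in
lemma expMart_succ (D l : ℝ) (s : ℕ → S) (j t : ℕ) :
    expMart M Φ θ oracle tie h D l s j (t + 1) = expMart M Φ θ oracle tie h D l s j t *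
      if j ≤ t ∧ played M Φ θ oracle tie s t = played M Φ θ oracle tie s j then
        Real.exp (-(l * ∫ y, h (played M Φ θ oracle tie s j) y
          ∂(M.policyKernel (played M Φ θ oracle tie s j).1 (s t)) + l ^ 2 * D ^ 2 / 8)) *
        Real.exp (l * h (played M Φ θ oracle tie s j) (s (t + 1)))
      else 1 := by
  unfold expMart count
  rw [Finset.sum_range_succ, Finset.sum_range_succ]
  unfold noise
  split_ifs with hc
  · rw [← Real.exp_add, ← Real.exp_add]
    congr 1
    push_cast
    ring
  · simp

variable {μ₀ : Measure S} [mΩ : MeasurableSpace Ω] {P : Measure Ω} [IsProbabilityMeasure P]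

/-- By the Markov property and Hoeffding's lemma each step multiplies the conditional expectation
by at most `1`. -/
lemma lintegral_expMart_le_one (hP : IsStateProcess M Φ θ oracle tie μ₀ P s)
    (hh : ∀ φ, Measurable (h φ)) {D : ℝ} (hD : ∀ φ y, |h φ y| ≤ D / 2) (l : ℝ) (j : ℕ) {t : ℕ}
    (ht : t ≤ θ.T) :
    ∫⁻ ω, ENNReal.ofReal (expMart M Φ θ oracle tie h D l (fun v => s v ω) j t) ∂P ≤ 1 := by
  classical
  induction t with
  | zero => simp [expMart, count]
  | succ t ih =>
    refine le_trans ?_ (ih (by omega))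
    by_cases hjt : j ≤ t
    swap
    · refine lintegral_mono fun ω => ?_
      rw [expMart_succ, if_neg fun hc => hjt hc.1, mul_one]
    have hd : IsDiscreteVar (history s t) fun ω =>
        (played M Φ θ oracle tie (fun v => s v ω) j, played M Φ θ oracle tie (fun v => s v ω) t) :=
      isDiscreteVar_played_pair hjt le_rfl
    set a : Φ × Φ → S → ℝ := fun d x =>
      if d.2 = d.1 then l * ∫ y, h d.1 y ∂(M.policyKernel d.1.1 x) + l ^ 2 * D ^ 2 / 8 else 0
      with ha
    set g : Φ × Φ → S → ℝ≥0∞ := fun d y =>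
      if d.2 = d.1 then ENNReal.ofReal (Real.exp (l * h d.1 y)) else 1 with hg
    set W : Ω → ℝ≥0∞ := fun ω =>
      ENNReal.ofReal (expMart M Φ θ oracle tie h D l (fun v => s v ω) j t *
        Real.exp (-a (played M Φ θ oracle tie (fun v => s v ω) j,
          played M Φ θ oracle tie (fun v => s v ω) t) (s t ω))) with hW
    have hgm : ∀ d, Measurable (g d) := by
      intro d
      by_cases hc : d.2 = d.1
      · simp only [hg, if_pos hc]
        exact (Real.measurable_exp.comp ((hh d.1).const_mul l)).ennreal_ofReal
      · simp only [hg, if_neg hc]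
        exact measurable_const
    have ham : ∀ d, Measurable (a d) := by
      intro d
      by_cases hc : d.2 = d.1
      · simp only [ha, if_pos hc]
        exact ((((hh d.1).stronglyMeasurable.integral_kernel
          (κ := M.policyKernel d.1.1)).measurable.const_mul l).add_const _)
      · simp only [ha, if_neg hc]
        exact measurable_const
    have hWm : Measurable[history s t] W := by
      refine (Measurable.mul (measurable_expMart hh D l j t) ?_).ennreal_ofReal
      refine Real.measurable_exp.comp (Measurable.neg ?_)
      exact hd.measurable_bind (g := fun d ω => a d (s t ω)) fun d =>
        (ham d).comp (measurable_history s le_rfl)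
    have hstep := hP.lintegral_mul_comp (by omega : t < θ.T) hd (π := Prod.snd)
      (fun ω => rfl) hgm hWm
    calc ∫⁻ ω, ENNReal.ofReal (expMart M Φ θ oracle tie h D l (fun v => s v ω) j (t + 1)) ∂P
        = ∫⁻ ω, W ω * g (played M Φ θ oracle tie (fun v => s v ω) j,
            played M Φ θ oracle tie (fun v => s v ω) t) (s (t + 1) ω) ∂P := by
          refine lintegral_congr fun ω => ?_
          rw [expMart_succ]
          simp only [hW, hg, ha]
          by_cases hc : played M Φ θ oracle tie (fun v => s v ω) t =
              played M Φ θ oracle tie (fun v => s v ω) j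
          · rw [if_pos ⟨hjt, hc⟩, if_pos hc, if_pos hc,
              ← ENNReal.ofReal_mul (by unfold expMart; positivity), mul_assoc]
          · rw [if_neg fun hc' => hc hc'.2, if_neg hc, if_neg hc]
            simp
      _ = _ := hstep
      _ ≤ _ := by
          refine lintegral_mono fun ω => ?_
          simp only [hW, hg, ha]
          by_cases hc : played M Φ θ oracle tie (fun v => s v ω) t =
              played M Φ θ oracle tie (fun v => s v ω) j
          · simp only [hc, if_true]
            refine (mul_le_mul_right (lintegral_exp_le_of_abs_le _ (hh _) (hD _) l) _).trans ?_
            rw [← ENNReal.ofReal_mul (by unfold expMart; positivity), mul_assoc, ← Real.exp_add,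
              neg_add_cancel, Real.exp_zero, mul_one]
          · simp [hc]

/-- The Azuma-Hoeffding inequality for a given number of plays. -/
lemma measure_noise_le (hP : IsStateProcess M Φ θ oracle tie μ₀ P s)
    (hh : ∀ φ, Measurable (h φ)) {D : ℝ} (hD0 : 0 < D) (hD : ∀ φ y, |h φ y| ≤ D / 2)
    {L : ℝ} (hL : 0 ≤ L) (j : ℕ) {t n : ℕ} (ht : t ≤ θ.T) (hn : 0 < n) :
    P {ω | count M Φ θ oracle tie (fun v => s v ω) j t = n ∧ D * √(L * n) ≤
        |∑ u ∈ Finset.range t, noise M Φ θ oracle tie h (fun v => s v ω) j u|} ≤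
      2 * ENNReal.ofReal (Real.exp (-2 * L)) := by
  have hn' : (0 : ℝ) < n := by exact_mod_cast hn
  have hexp : 0 < Real.exp (2 * L) := Real.exp_pos _
  -- the exponent that minimizes the Chernoff bound
  set l₀ : ℝ := 4 * √(L / n) / D with hl₀
  have hone : ∀ l : ℝ,
      P {ω | Real.exp (2 * L) ≤ expMart M Φ θ oracle tie h D l (fun v => s v ω) j t} ≤
        ENNReal.ofReal (Real.exp (-2 * L)) := by
    intro l
    have hm : Measurable fun ω =>
        ENNReal.ofReal (expMart M Φ θ oracle tie h D l (fun v => s v ω) j t) :=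
      ((measurable_expMart hh D l j t).mono (history_le hP.measurable t) le_rfl).ennreal_ofReal
    have hmk := meas_ge_le_lintegral_div (μ := P) hm.aemeasurable
      (ε := ENNReal.ofReal (Real.exp (2 * L))) (by simpa using hexp) ENNReal.ofReal_ne_top
    calc _ ≤ P {ω | ENNReal.ofReal (Real.exp (2 * L)) ≤
          ENNReal.ofReal (expMart M Φ θ oracle tie h D l (fun v => s v ω) j t)} :=
          measure_mono fun ω hω => ENNReal.ofReal_le_ofReal hω
      _ ≤ _ := hmk
      _ ≤ 1 / ENNReal.ofReal (Real.exp (2 * L)) := by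
          gcongr
          exact lintegral_expMart_le_one hP hh hD l j ht
      _ = _ := by
          rw [one_div, ← ENNReal.ofReal_inv_of_pos hexp, ← Real.exp_neg]
          ring_nf
  have hsub : {ω | count M Φ θ oracle tie (fun v => s v ω) j t = n ∧ D * √(L * n) ≤
        |∑ u ∈ Finset.range t, noise M Φ θ oracle tie h (fun v => s v ω) j u|} ⊆
      {ω | Real.exp (2 * L) ≤ expMart M Φ θ oracle tie h D l₀ (fun v => s v ω) j t} ∪
      {ω | Real.exp (2 * L) ≤ expMart M Φ θ oracle tie h D (-l₀) (fun v => s v ω) j t} := by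
    rintro ω ⟨hcount, hge⟩
    have hsq : √(L / n) * √(L * n) = L := by
      rw [← mul_sqrt_div_eq hL, mul_left_comm, Real.mul_self_sqrt (by positivity),
        mul_div_cancel₀ _ hn'.ne']
    have e1 : l₀ ^ 2 * D ^ 2 / 8 * n = 2 * L := by
      rw [hl₀, div_pow, mul_pow, Real.sq_sqrt (by positivity)]
      field_simp
      ring
    have e2 : l₀ * (D * √(L * n)) = 4 * L := by
      calc l₀ * (D * √(L * n)) = 4 * (√(L / n) * √(L * n)) := by
            rw [hl₀]; field_simp
        _ = 4 * L := by rw [hsq]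
    have hl0 : 0 ≤ l₀ := by positivity
    rcases le_abs'.1 hge with hle | hle
    · right
      refine Real.exp_le_exp.2 ?_
      rw [hcount, neg_sq, e1]
      have := mul_le_mul_of_nonneg_left hle hl0
      linarith
    · left
      refine Real.exp_le_exp.2 ?_
      rw [hcount, e1]
      have := mul_le_mul_of_nonneg_left hle hl0
      linarith
  calc _ ≤ _ := measure_mono hsub
    _ ≤ _ := measure_union_le _ _
    _ ≤ _ := add_le_add (hone _) (hone _)
    _ = _ := (two_mul _).symm

end

end PZRL

/-! ### The good event, and the constants -/

namespace PZRL

section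

variable {S A : Type*} [MeasurableSpace S] [MeasurableSpace A]
  {M : MDP S A} {Φ : Set (Policy S A)} [Nonempty Φ] {θ : Params}
  {oracle : Finset (Φ × ℝ) → Option Φ} {tie : Finset Φ → Φ} {h : Φ → S → ℝ} {J : Φ → ℝ}

/-- Each policy that has been played is the one played at the time `j` of its first play, so its
excess rewards are a telescoping sum plus the noise indexed by `j`. -/
lemma concentrated_memory
    (hpois : ∀ φ : Φ, ∀ x, M.policyReward φ.1 x - J φ =
      h φ x - ∫ y, h φ y ∂(M.policyKernel φ.1 x))
    (hD : ∀ φ y, |h φ y| ≤ scale θ / 2) (hs : 0 ≤ scale θ) (s : ℕ → S)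
    (hgood : ∀ j < θ.T, ∀ t ≤ θ.T, 0 < count M Φ θ oracle tie s j t →
      |∑ u ∈ Finset.range t, noise M Φ θ oracle tie h s j u| ≤
        scale θ * √(level θ * count M Φ θ oracle tie s j t)) :
    Concentrated θ J (memory M Φ θ oracle tie s) := by
  classical
  intro t ht φ
  have hrun := isRun_memory M Φ θ oracle tie s
  have hN := hrun.plays_eq_sum t φ
  have htot := hrun.total_eq_sum t φ
  by_cases hex : ∃ j, j < t ∧ played M Φ θ oracle tie s j = φ
  · obtain ⟨hjt, hjφ⟩ := Nat.find_spec hex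
    have hmin : ∀ u < t, played M Φ θ oracle tie s u = φ → Nat.find hex ≤ u :=
      fun u hu huφ => Nat.find_min' hex ⟨hu, huφ⟩
    generalize Nat.find hex = j at hjt hjφ hmin
    have hiff : ∀ u < t, (j ≤ u ∧ played M Φ θ oracle tie s u = played M Φ θ oracle tie s j) ↔
        played M Φ θ oracle tie s u = φ := fun u hu =>
      ⟨fun hc => hc.2.trans hjφ, fun hc => ⟨hmin u hu hc, hc.trans hjφ.symm⟩⟩
    have hcount : count M Φ θ oracle tie s j t = (memory M Φ θ oracle tie s t).plays φ := by
      rw [hN]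
      refine Finset.sum_congr rfl fun u hu => ?_
      exact if_congr (hiff u (Finset.mem_range.1 hu)) rfl rfl
    have hpos : 0 < count M Φ θ oracle tie s j t := by
      rw [hcount, hN]
      refine Finset.sum_pos' (fun _ _ => Nat.zero_le _) ⟨j, Finset.mem_range.2 hjt, ?_⟩
      exact (if_pos hjφ).symm ▸ one_pos
    have h1 := hgood j (by omega) t ht hpos
    rw [hcount] at h1
    have h2 := hrun.abs_telescope_le (h := fun u => h φ (s u)) (fun u => hD φ _) φ t
    have h3 : (memory M Φ θ oracle tie s t).total φ -
        (memory M Φ θ oracle tie s t).plays φ * J φ =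
        (∑ u ∈ Finset.range t, if (startStep θ oracle tie (memory M Φ θ oracle tie s u)).current = φ
          then h φ (s u) - h φ (s (u + 1)) else 0) +
        ∑ u ∈ Finset.range t, noise M Φ θ oracle tie h s j u := by
      rw [htot, hN]
      push_cast
      rw [Finset.sum_mul, ← Finset.sum_sub_distrib, ← Finset.sum_add_distrib]
      refine Finset.sum_congr rfl fun u hu => ?_
      unfold noise
      by_cases hc : played M Φ θ oracle tie s u = φ
      · have hc' : (startStep θ oracle tie (memory M Φ θ oracle tie s u)).current = φ := hc
        rw [if_pos hc', if_pos hc', if_pos hc', if_pos ((hiff u (Finset.mem_range.1 hu)).2 hc),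
          hjφ, hc, one_mul, hpois]
        ring
      · have hc' : ¬ (startStep θ oracle tie (memory M Φ θ oracle tie s u)).current = φ := hc
        rw [if_neg hc', if_neg hc', if_neg hc',
          if_neg fun hc'' => hc ((hiff u (Finset.mem_range.1 hu)).1 hc'')]
        ring
    rw [h3]
    refine (abs_add_le _ _).trans ?_
    linarith
  · push Not at hex
    have h0 : (memory M Φ θ oracle tie s t).plays φ = 0 := by
      rw [hN]
      exact Finset.sum_eq_zero fun u hu => if_neg (hex u (Finset.mem_range.1 hu))
    have h1 : (memory M Φ θ oracle tie s t).total φ = 0 := by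
      rw [htot]
      exact Finset.sum_eq_zero fun u hu => if_neg (hex u (Finset.mem_range.1 hu))
    rw [h0, h1]
    simp only [Nat.cast_zero, zero_mul, sub_zero, abs_zero]
    positivity

variable {μ₀ : Measure S} {Ω : Type*} [mΩ : MeasurableSpace Ω] {P : Measure Ω}
  [IsProbabilityMeasure P] {s : ℕ → Ω → S}

/-- A union bound over the time of the first play, the current time and the number of plays. -/
lemma measure_not_concentrated_le (hP : IsStateProcess M Φ θ oracle tie μ₀ P s)
    (hh : ∀ φ, Measurable (h φ))
    (hpois : ∀ φ : Φ, ∀ x, M.policyReward φ.1 x - J φ =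
      h φ x - ∫ y, h φ y ∂(M.policyKernel φ.1 x))
    (hD : ∀ φ y, |h φ y| ≤ scale θ / 2) (hs : 0 < scale θ) (hL : 0 ≤ level θ) :
    P {ω | ¬ Concentrated θ J (memory M Φ θ oracle tie fun u => s u ω)} ≤
      ENNReal.ofReal (2 * θ.T ^ 2 * (θ.T + 1) * Real.exp (-2 * level θ)) := by
  classical
  set I := Finset.range θ.T ×ˢ Finset.range (θ.T + 1) ×ˢ Finset.Icc 1 θ.T
  set E : ℕ × ℕ × ℕ → Set Ω := fun i =>
    {ω | count M Φ θ oracle tie (fun v => s v ω) i.1 i.2.1 = i.2.2 ∧ scale θ * √(level θ * i.2.2) ≤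
      |∑ u ∈ Finset.range i.2.1, noise M Φ θ oracle tie h (fun v => s v ω) i.1 u|}
  have hsub : {ω | ¬ Concentrated θ J (memory M Φ θ oracle tie fun u => s u ω)} ⊆
      ⋃ i ∈ I, E i := by
    intro ω hω
    by_contra hnot
    refine hω (concentrated_memory hpois hD hs.le _ fun j hj t ht hpos => ?_)
    by_contra hlt
    refine hnot (Set.mem_biUnion (x := (j, t, count M Φ θ oracle tie (fun v => s v ω) j t)) ?_
      ⟨rfl, (not_le.1 hlt).le⟩)
    have hle : count M Φ θ oracle tie (fun v => s v ω) j t ≤ t := by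
      unfold count
      calc _ ≤ ∑ u ∈ Finset.range t, 1 := Finset.sum_le_sum fun u _ => by split_ifs <;> simp
        _ = t := by simp
    simp only [I, Finset.coe_product, Set.mem_prod, Finset.mem_coe, Finset.mem_range,
      Finset.mem_Icc]
    omega
  calc _ ≤ P (⋃ i ∈ I, E i) := measure_mono hsub
    _ ≤ ∑ i ∈ I, P (E i) := measure_biUnion_finset_le _ _
    _ ≤ ∑ i ∈ I, 2 * ENNReal.ofReal (Real.exp (-2 * level θ)) := by
        refine Finset.sum_le_sum fun i hi => ?_
        simp only [I, Finset.mem_product, Finset.mem_range, Finset.mem_Icc] at hi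
        exact measure_noise_le hP hh hs hD hL i.1 (by omega) (by omega)
    _ = _ := by
        rw [Finset.sum_const, nsmul_eq_mul]
        have : I.card = θ.T * ((θ.T + 1) * θ.T) := by simp [I]
        rw [this, ← ENNReal.ofReal_natCast, ← ENNReal.ofReal_ofNat 2,
          ← ENNReal.ofReal_mul (by norm_num), ← ENNReal.ofReal_mul (by positivity)]
        congr 1
        push_cast
        ring

end

section Constants

/-- The admissible values of `c_d` make the confidence level so high that the union bound
succeeds. -/
lemma le_level_of_cdLowerBound_le {θ : Params} {cz : ℝ} (hcz : 4 ≤ cz) (hT : 2 ≤ θ.T)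
    (hδ0 : 0 < θ.δ) (hδ1 : θ.δ < 1) (hcd : cdLowerBound cz 0 θ.δ θ.T ≤ θ.cd) :
    Real.log (θ.T / θ.δ) ≤ level θ ∧
      2 * θ.T ^ 2 * (θ.T + 1) * Real.exp (-2 * level θ) ≤ θ.δ := by
  have hT' : (2 : ℝ) ≤ θ.T := by exact_mod_cast hT
  have hT0 : (0 : ℝ) < θ.T := by linarith
  have hTδ : 1 < (θ.T : ℝ) / θ.δ := by rw [lt_div_iff₀ hδ0]; linarith
  have hΛ : 0 < Real.log (θ.T / θ.δ) := Real.log_pos hTδ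
  unfold cdLowerBound at hcd
  rw [div_le_iff₀ hΛ] at hcd
  set R : ℝ := (θ.T : ℝ) ^ (((0 : ℝ) + 3) / (0 + 2)) with hR
  have hR2 : R ^ 2 = (θ.T : ℝ) ^ 3 := by
    rw [hR, ← Real.rpow_natCast, ← Real.rpow_mul hT0.le, ← Real.rpow_natCast]
    norm_num
  have hR1 : (θ.T : ℝ) ≤ R := by
    rw [hR]
    conv_lhs => rw [← Real.rpow_one (θ.T : ℝ)]
    exact Real.rpow_le_rpow_of_exponent_le (by linarith) (by norm_num)
  have hR0 : 0 < R := by linarith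
  have h2 : (2 : ℝ) ^ ((0 : ℝ) + 2) = 4 := by
    rw [zero_add, Real.rpow_ofNat]; norm_num
  rw [h2] at hcd
  have hle : Real.log (16 * R / θ.δ) ≤ level θ := by
    refine le_trans (Real.log_le_log (by positivity) ?_) hcd
    rw [div_mul_eq_mul_div, div_mul_eq_mul_div]
    gcongr
    linarith
  refine ⟨le_trans (Real.log_le_log (by positivity) ?_) hle, ?_⟩
  · gcongr
    linarith
  · have hexp : Real.exp (-2 * level θ) ≤ θ.δ ^ 2 / (256 * θ.T ^ 3) := by
      calc Real.exp (-2 * level θ) ≤ Real.exp (-2 * Real.log (16 * R / θ.δ)) :=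
            Real.exp_le_exp.2 (by linarith)
        _ = ((16 * R / θ.δ) ^ 2)⁻¹ := by
            rw [neg_mul, Real.exp_neg, ← Real.exp_log (x := (16 * R / θ.δ) ^ 2) (by positivity),
              Real.log_pow]
            norm_num
        _ = _ := by
            rw [div_pow, mul_pow, hR2, inv_div]
            norm_num
    calc 2 * (θ.T : ℝ) ^ 2 * (θ.T + 1) * Real.exp (-2 * level θ)
        ≤ 2 * (θ.T : ℝ) ^ 2 * (θ.T + θ.T) * (θ.δ ^ 2 / (256 * θ.T ^ 3)) := by
          gcongr
          linarith
      _ = θ.δ * (θ.δ / 64) := by field_simp; ring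
      _ ≤ θ.δ * 1 := by gcongr; linarith
      _ = θ.δ := mul_one _

/-- The regret bound in terms of `log (T / δ)`, for at most logarithmically many active policies. -/
lemma regret_bound_le {T : ℕ} {n Λ L η B D LJ : ℝ} (hT : 2 ≤ T) (hη : 0 < η) (hD : 0 ≤ D)
    (hLJ : 0 ≤ LJ) (hn : n ≤ Real.log (√(T : ℝ) + 1) / η + 1) (hΛ : Real.log T ≤ Λ)
    (hL : L ≤ B * Λ) (hB : 0 ≤ B) :
    (5 + 2 * LJ) * D * (√L * √(n * T) + n * (1 + Real.log (4 * T) / Real.log 2)) ≤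
      (5 + 2 * LJ) * D * ((√(B * (2 / η + 1 / Real.log 2)) +
        4 * (2 / η + 1 / Real.log 2)) / Real.log 2) * √(T : ℝ) * Λ ^ 2 := by
  have hT' : (2 : ℝ) ≤ T := by exact_mod_cast hT
  have hl2 : 0 < Real.log 2 := Real.log_pos one_lt_two
  have hΛ2 : Real.log 2 ≤ Λ := (Real.log_le_log (by norm_num) hT').trans hΛ
  have hΛ0 : 0 < Λ := hl2.trans_le hΛ2
  have hone : 1 ≤ Λ / Real.log 2 := (one_le_div hl2).2 hΛ2
  have hsT : 1 ≤ √(T : ℝ) := Real.one_le_sqrt.2 (by linarith)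
  set b := 2 / η + 1 / Real.log 2 with hb
  have hb0 : 0 < b := by positivity
  have hnb : n ≤ b * Λ := by
    have h1 : Real.log (√(T : ℝ) + 1) ≤ 2 * Λ := by
      have h2 : √(T : ℝ) ≤ T := Real.sqrt_le_left (by linarith) |>.2 (by nlinarith)
      calc Real.log (√(T : ℝ) + 1) ≤ Real.log ((T : ℝ) ^ 2) :=
            Real.log_le_log (by positivity) (by nlinarith)
        _ = 2 * Real.log T := by rw [Real.log_pow]; norm_num
        _ ≤ 2 * Λ := by linarith
    calc n ≤ Real.log (√(T : ℝ) + 1) / η + 1 := hn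
      _ ≤ 2 * Λ / η + Λ / Real.log 2 := by gcongr
      _ = b * Λ := by rw [hb]; ring
  have hlog : 1 + Real.log (4 * T) / Real.log 2 ≤ 4 * Λ / Real.log 2 := by
    have h4 : 4 ≤ (T : ℝ) ^ 2 := by nlinarith
    have h1 : Real.log (4 * T) ≤ 3 * Λ := by
      calc Real.log (4 * T) ≤ Real.log ((T : ℝ) ^ 3) :=
            Real.log_le_log (by positivity) (by nlinarith)
        _ = 3 * Real.log T := by rw [Real.log_pow]; norm_num
        _ ≤ 3 * Λ := by linarith
    calc 1 + Real.log (4 * T) / Real.log 2 ≤ Λ / Real.log 2 + 3 * Λ / Real.log 2 := by gcongr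
      _ = _ := by ring
  have hlog0 : 0 ≤ 1 + Real.log (4 * T) / Real.log 2 := by
    have : 0 ≤ Real.log (4 * T) := Real.log_nonneg (by linarith)
    positivity
  have e1 : √L * √(n * T) ≤ √(B * b) / Real.log 2 * √(T : ℝ) * Λ ^ 2 := by
    calc √L * √(n * T) ≤ √(B * Λ) * √(b * Λ * T) := by gcongr
      _ = √(B * b) * √(T : ℝ) * Λ := by
          rw [← Real.sqrt_mul (by positivity), ← Real.sqrt_mul (by positivity),
            show B * Λ * (b * Λ * T) = B * b * T * Λ ^ 2 by ring,
            Real.sqrt_mul (by positivity), Real.sqrt_sq hΛ0.le]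
      _ ≤ √(B * b) * √(T : ℝ) * Λ * (Λ / Real.log 2) := le_mul_of_one_le_right (by positivity) hone
      _ = _ := by ring
  have e2 : n * (1 + Real.log (4 * T) / Real.log 2) ≤ 4 * b / Real.log 2 * √(T : ℝ) * Λ ^ 2 := by
    calc n * (1 + Real.log (4 * T) / Real.log 2) ≤ b * Λ * (4 * Λ / Real.log 2) := by gcongr
      _ ≤ b * Λ * (4 * Λ / Real.log 2) * √(T : ℝ) := le_mul_of_one_le_right (by positivity) hsT
      _ = _ := by ring
  calc _ ≤ (5 + 2 * LJ) * D * (√(B * b) / Real.log 2 * √(T : ℝ) * Λ ^ 2 +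
        4 * b / Real.log 2 * √(T : ℝ) * Λ ^ 2) := by gcongr
    _ = _ := by ring

end Constants

end PZRL

end

/-! ### The regret of PZRL-MF -/

theorem mainTheorem5
    {S A : Type*} [MetricSpace S] [MeasurableSpace S] [BorelSpace S]
    [MetricSpace A] [MeasurableSpace A] [BorelSpace A]
    (M : MDP S A) (μ₀ : Measure S) [IsProbabilityMeasure μ₀]
    (Lr Lp : ℝ) (hLip : M.IsLipschitz Lr Lp)
    (Φ : Set (Policy S A)) [Nonempty Φ] [PseudoMetricSpace Φ]
    (C α : ℝ) (hErg : M.IsUniformlyErgodic Φ C α)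
    (L₁ L₂ : ℝ) (hL₂ : 0 < L₂) (hL : L₂ ≤ L₁)
    (hbi : ∀ φ₁ φ₂ : Φ,
      L₂ * dist φ₁ φ₂ ≤ |M.avgReward μ₀ φ₁ - M.avgReward μ₀ φ₂| ∧
      |M.avgReward μ₀ φ₁ - M.avgReward μ₀ φ₂| ≤ L₁ * dist φ₁ φ₂)
    (LJ : ℝ) (hLJ₀ : 0 ≤ LJ)
    (hLJ : ∀ φ₁ φ₂ : Φ, |M.avgReward μ₀ φ₁ - M.avgReward μ₀ φ₂| ≤ LJ * dist φ₁ φ₂)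
    (Cub : ℝ) :
    ∃ cz₁ > 0, ∃ cz₂ > 0,
      zoomingDim M μ₀ Φ (zoomScale LJ Cub) cz₁ cz₂ = 0 ∧
      ∀ cdMax : ℝ, ∃ (K : ℝ) (k : ℕ),
        ∀ θ : PZRL.Params, 2 ≤ θ.T → 0 < θ.δ → θ.δ < 1 → θ.C = C → θ.α = α → θ.LJ = LJ →
        PZRL.cdLowerBound (zoomScale LJ Cub)
          (zoomingDim M μ₀ Φ (zoomScale LJ Cub) cz₁ cz₂).toReal θ.δ θ.T ≤ θ.cd →
        θ.cd ≤ cdMax →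
        ∀ (oracle : Finset (Φ × ℝ) → Option Φ) (tie : Finset Φ → Φ),
          PZRL.IsCoverOracle oracle → (∀ B : Finset Φ, B.Nonempty → tie B ∈ B) →
        ∀ (Ω : Type*) [MeasurableSpace Ω] (P : Measure Ω) [IsProbabilityMeasure P]
          (s : ℕ → Ω → S), PZRL.IsStateProcess M Φ θ oracle tie μ₀ P s →
          ENNReal.ofReal (1 - θ.δ) ≤
            P {ω | PZRL.regret M Φ θ oracle tie μ₀ (fun t => s t ω) ≤
              K * √(θ.T : ℝ) * Real.log (θ.T / θ.δ) ^ k} := by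
  have hJ : ∀ φ : Φ, M.avgReward μ₀ φ ∈ Set.Icc (0 : ℝ) 1 := fun φ =>
    MDP.avgReward_mem_Icc hErg φ.2 μ₀
  have hcz : 4 ≤ zoomScale LJ Cub := by
    unfold zoomScale
    linarith [le_max_left 2 Cub]
  obtain ⟨cz₁, hcz₁, cz₂, hcz₂, hdim⟩ := exists_zoomingDim_eq_zero (M := M) (μ₀ := μ₀) hJ hL₂
    (by linarith : 0 < zoomScale LJ Cub) fun φ ψ => (hbi φ ψ).1
  refine ⟨cz₁, hcz₁, cz₂, hcz₂, hdim, fun cdMax => ?_⟩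
  rw [hdim, ENNReal.toReal_zero]
  obtain ⟨hC, -, hα1, -⟩ := id hErg
  have hD : 0 < C / (1 - α) := div_pos hC (by linarith)
  choose h hh hhD hpois using fun φ : Φ => MDP.exists_poisson hErg φ.2 μ₀
  have hη : 0 < Real.log (1 + L₂ / (4 * (2 + LJ))) := by
    refine Real.log_pos ?_
    have : 0 < L₂ / (4 * (2 + LJ)) := by positivity
    linarith
  have hl2 : 0 < Real.log 2 := Real.log_pos one_lt_two
  -- `K₁` is for horizons so large that unplayed policies have radius at least `1`, and `K₂` for
  -- the other ones, which are bounded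
  obtain ⟨K₁, hK₁⟩ : ∃ K₁, K₁ = (5 + 2 * LJ) * (C / (1 - α)) *
      ((√(max cdMax 0 * (2 / Real.log (1 + L₂ / (4 * (2 + LJ))) + 1 / Real.log 2)) +
        4 * (2 / Real.log (1 + L₂ / (4 * (2 + LJ))) + 1 / Real.log 2)) / Real.log 2) := ⟨_, rfl⟩
  obtain ⟨K₂, hK₂⟩ : ∃ K₂, K₂ = Real.exp (1 / (C / (1 - α)) ^ 2) / Real.log 2 ^ 2 := ⟨_, rfl⟩
  have hK₁0 : 0 ≤ K₁ := by rw [hK₁]; positivity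
  have hK₂0 : 0 ≤ K₂ := by rw [hK₂]; positivity
  refine ⟨K₁ + K₂, 2, ?_⟩
  intro θ hT hδ0 hδ1 hθC hθα hθLJ hcd hcdMax oracle tie ho htie Ω _ P _ s hP
  have hT' : (2 : ℝ) ≤ θ.T := by exact_mod_cast hT
  have hTδ : (θ.T : ℝ) ≤ θ.T / θ.δ := by
    rw [le_div_iff₀ hδ0]
    exact mul_le_of_le_one_right (by linarith) hδ1.le
  have hΛT : Real.log θ.T ≤ Real.log (θ.T / θ.δ) := Real.log_le_log (by linarith) hTδ
  have hΛ2 : Real.log 2 ≤ Real.log (θ.T / θ.δ) :=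
    (Real.log_le_log (by norm_num) hT').trans hΛT
  have hΛ0 : 0 < Real.log (θ.T / θ.δ) := hl2.trans_le hΛ2
  have hsT : 1 ≤ √(θ.T : ℝ) := Real.one_le_sqrt.2 (by linarith)
  have hscale : PZRL.scale θ = C / (1 - α) := by unfold PZRL.scale; rw [hθC, hθα]
  obtain ⟨hlev, hunion⟩ := PZRL.le_level_of_cdLowerBound_le hcz hT hδ0 hδ1 hcd
  have hlev0 : 0 ≤ PZRL.level θ := hΛ0.le.trans hlev
  by_cases hlarge : 1 ≤ (C / (1 - α)) ^ 2 * Real.log (θ.T / θ.δ)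
  · have hR : PZRL.Regular θ (fun φ : Φ => M.avgReward μ₀ φ) L₂ (M.optReward μ₀ Φ) :=
      { scale_pos := hscale ▸ hD
        LJ_nonneg := hθLJ ▸ hLJ₀
        c_pos := hL₂
        mem_Icc := hJ
        isLUB := isLUB_ciSup ⟨1, by rintro _ ⟨ψ, rfl⟩; exact (hJ ψ).2⟩
        mul_dist_le := fun φ ψ => (hbi φ ψ).1
        abs_sub_le := fun φ ψ => hθLJ ▸ hLJ φ ψ
        one_le := by
          rw [hscale, ← Real.sqrt_sq hD.le, ← Real.sqrt_mul (sq_nonneg _)]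
          refine Real.one_le_sqrt.2 (hlarge.trans ?_)
          gcongr }
    have hbad := PZRL.measure_not_concentrated_le (J := fun φ : Φ => M.avgReward μ₀ φ) hP hh hpois
      (by rw [hscale]; exact hhD) hR.scale_pos hlev0
    have hgood : {ω | ¬ PZRL.Concentrated θ (fun φ : Φ => M.avgReward μ₀ φ)
        (PZRL.memory M Φ θ oracle tie fun u => s u ω)}ᶜ ⊆
        {ω | PZRL.regret M Φ θ oracle tie μ₀ (fun t => s t ω) ≤
          (K₁ + K₂) * √(θ.T : ℝ) * Real.log (θ.T / θ.δ) ^ 2} := by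
      intro ω hω
      have hcon := not_not.1 hω
      have hrun := PZRL.isRun_memory M Φ θ oracle tie fun u => s u ω
      have h1 := hrun.regret_le hR hcon ho htie (by omega)
      have h2 := hrun.card_active_le hR hcon ho htie (by omega)
      rw [hscale, hθLJ] at h1
      rw [hθLJ] at h2
      have h3 := PZRL.regret_bound_le (L := PZRL.level θ) hT hη hD.le hLJ₀ h2 hΛT
        (mul_le_mul_of_nonneg_right (hcdMax.trans (le_max_left _ 0)) hΛ0.le) (le_max_right _ _)
      rw [← hK₁] at h3
      refine (h1.trans h3).trans ?_
      gcongr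
      linarith
    calc ENNReal.ofReal (1 - θ.δ) = 1 - ENNReal.ofReal θ.δ := by
          rw [ENNReal.ofReal_sub _ hδ0.le, ENNReal.ofReal_one]
      _ ≤ 1 - P {ω | ¬ PZRL.Concentrated θ (fun φ : Φ => M.avgReward μ₀ φ)
            (PZRL.memory M Φ θ oracle tie fun u => s u ω)} :=
          tsub_le_tsub_left (hbad.trans (ENNReal.ofReal_le_ofReal hunion)) _
      _ ≤ P {ω | ¬ PZRL.Concentrated θ (fun φ : Φ => M.avgReward μ₀ φ)
            (PZRL.memory M Φ θ oracle tie fun u => s u ω)}ᶜ := by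
          rw [tsub_le_iff_left, ← measure_univ (μ := P), ← Set.union_compl_self]
          exact measure_union_le _ _
      _ ≤ _ := measure_mono hgood
  · have hall : {ω | PZRL.regret M Φ θ oracle tie μ₀ (fun t => s t ω) ≤
          (K₁ + K₂) * √(θ.T : ℝ) * Real.log (θ.T / θ.δ) ^ 2} = Set.univ := by
      refine Set.eq_univ_of_forall fun ω => ?_
      have h1 : PZRL.regret M Φ θ oracle tie μ₀ (fun t => s t ω) ≤ θ.T := by
        have h2 : M.optReward μ₀ Φ ≤ 1 := ciSup_le fun ψ => (hJ ψ).2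
        have h3 : 0 ≤ ∑ t ∈ Finset.range θ.T, M.reward (s t ω,
            PZRL.action M Φ θ oracle tie (fun t => s t ω) t) :=
          Finset.sum_nonneg fun t _ => (M.reward_mem _).1
        unfold PZRL.regret
        nlinarith
      have h2 : (θ.T : ℝ) ≤ Real.exp (1 / (C / (1 - α)) ^ 2) := by
        rw [← Real.log_le_iff_le_exp (by linarith), le_div_iff₀ (by positivity)]
        nlinarith [sq_nonneg (C / (1 - α))]
      refine h1.trans (h2.trans ?_)
      have hexp : Real.exp (1 / (C / (1 - α)) ^ 2) = K₂ * 1 * Real.log 2 ^ 2 := by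
        rw [hK₂]; field_simp
      rw [hexp]
      gcongr
      linarith
    rw [hall, measure_univ]
    exact ENNReal.ofReal_le_one.2 (by linarith)
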